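/- Let $d\ge 1$, let $V\in C^2(\mathbb R^d,\mathbb R)$, and let $S$ be the set of all local minimizers of $V$. Assume: 1. (Local PŁ condition.) Every connected component $S'$ of $S$ has an open neighborhood $\mathcal N(S')\supset S'$ on which $V$ is of class $C^3$, attains its minimum, and satisfies, for some constant $\nu>0$, $$|\nabla V(x)|^2\ \ge\ \nu\Bigl(V(x)-\min_{\mathcal N(S')}V\Bigr)\qquad\text{for all }x\in\mathcal N(S').$$ 2. (No saddle points.) If $x\in\mathbb R^d$ lies outside the union of all the neighborhoods $\mathcal N(S')$ and $\nabla V(x)=0$, then the Hessian $\nabla^2V(x)$ is negative definite. 3. (Behavior at infinity.) At least one of the following holds: (a) $V$ is coercive, i.e. $V(x)\to+\infty$ as $|x|\to\infty$, and $S$ is contained in a compact set; or (b) $S\neq\emptyset$ and there are $R_0>0$ and $\nu_{eb}>0$ such that $|x|\le R_0$ for all $x\in S$ and $|\nabla V(x)|\ge \nu_{eb}\,\mathrm{dist}(x,S)$ for all $|x|\ge R_0$. Then there is an integer $k$ with $0\le k<d$ such that $S$ is a compact $k$-dimensional $C^2$ embedded submanifold of $\mathbb R^d$ without boundary, and the same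 holds, with the same $k$, for the set of all global minimizers of $V$. Here a $k$-dimensional $C^2$ embedded submanifold without boundary is a subset $M\subseteq\mathbb R^d$ that, with the subspace topology, carries the structure of a $C^2$ manifold modelled on $\mathbb R^k$ (without boundary) for which the inclusion $M\hookrightarrow\mathbb R^d$ is a $C^2$ embedding, i.e. a $C^2$ immersion that is a homeomorphism onto its image. The empty set counts as such a submanifold of every dimension; it can occur here only as the set of global minimizers, when $d=1$ and (a) fails. -/

import Mathlib

open Set Filter Topology
open scoped Manifold ContDiff Gradient

/-- The set of all local minimizers of `V`. -/
def localMinimizers {d : ℕ} (V : EuclideanSpace ℝ (Fin d) → ℝ) :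
    Set (EuclideanSpace ℝ (Fin d)) :=
  {x | IsLocalMin V x}

/-- The set of all global minimizers of `V`. -/
def globalMinimizers {d : ℕ} (V : EuclideanSpace ℝ (Fin d) → ℝ) :
    Set (EuclideanSpace ℝ (Fin d)) :=
  {x | ∀ y, V x ≤ V y}

/-- The collection of connected components of a subset `S` of a topological space. -/
def componentsOf {X : Type*} [TopologicalSpace X] (S : Set X) : Set (Set X) :=
  {C | ∃ x ∈ S, C = connectedComponentIn S x}

/-- The family `N` assigns to every connected component `C` of the set of local minimizers of `V`
an open neighbourhood `N C` of `C` on which `V` is of class `C³`, attains its minimum, and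
satisfies the Polyak-Łojasiewicz inequality with some constant `ν > 0`. -/
def IsLocallyPL {d : ℕ} (V : EuclideanSpace ℝ (Fin d) → ℝ)
    (N : Set (EuclideanSpace ℝ (Fin d)) → Set (EuclideanSpace ℝ (Fin d))) : Prop :=
  ∀ C ∈ componentsOf (localMinimizers V),
    IsOpen (N C) ∧ C ⊆ N C ∧ ContDiffOn ℝ 3 V (N C) ∧
      ∃ ν > 0, ∃ m, IsLeast (V '' N C) m ∧ ∀ x ∈ N C, ν * (V x - m) ≤ ‖∇ V x‖ ^ 2

/-- Outside the union of the neighbourhoods `N C`, the Hessian of `V` is negative definite at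
every critical point of `V`. -/
def HasNoSaddleOutside {d : ℕ} (V : EuclideanSpace ℝ (Fin d) → ℝ)
    (N : Set (EuclideanSpace ℝ (Fin d)) → Set (EuclideanSpace ℝ (Fin d))) : Prop :=
  ∀ x ∉ ⋃ C ∈ componentsOf (localMinimizers V), N C,
    ∇ V x = 0 → ∀ v ≠ 0, fderiv ℝ (fderiv ℝ V) x v v < 0

/-- `V` is coercive and all its local minimizers lie in a compact set. -/
def IsCoerciveWithBoundedMinima {d : ℕ} (V : EuclideanSpace ℝ (Fin d) → ℝ) : Prop :=
  Tendsto V (cocompact (EuclideanSpace ℝ (Fin d))) atTop ∧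
    ∃ K, IsCompact K ∧ localMinimizers V ⊆ K

/-- The error bound `‖∇ V x‖ ≥ ν * dist (x, S)` holds outside a ball that contains the (nonempty)
set `S` of local minimizers. Nonemptiness is what makes the distance to `S` finite. -/
def HasErrorBoundAtInfinity {d : ℕ} (V : EuclideanSpace ℝ (Fin d) → ℝ) : Prop :=
  (localMinimizers V).Nonempty ∧
    ∃ R > 0, ∃ ν > 0, (∀ x ∈ localMinimizers V, ‖x‖ ≤ R) ∧
      ∀ x, R ≤ ‖x‖ → ν * Metric.infDist x (localMinimizers V) ≤ ‖∇ V x‖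

/-- `M ⊆ ℝ^d` is a `k`-dimensional `C²` embedded submanifold without boundary: with the subspace
topology it carries the structure of a `C²` manifold modelled on `ℝ^k`, with empty boundary, for
which the inclusion into `ℝ^d` is a `C²` embedding (an immersion and a homeomorphism onto its
image). -/
def IsC2EmbeddedSubmanifold {d : ℕ} (k : ℕ) (M : Set (EuclideanSpace ℝ (Fin d))) : Prop :=
  ∃ _ : ChartedSpace (EuclideanSpace ℝ (Fin k)) M,
    IsManifold (𝓡 k) 2 M ∧ (𝓡 k).boundary M = ∅ ∧
      Manifold.IsSmoothEmbedding (𝓡 k) (𝓡 d) 2 (Subtype.val : M → EuclideanSpace ℝ (Fin d))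

/-! The local part is a Lyapunov–Schmidt reduction. At a local minimizer `x` let `K` be the kernel
of the Hessian and `P` the orthogonal projection onto `K`. The Hessian is symmetric, so `Φ y = P (y
- x) + (1 - P) (∇ V y)` is a `C²` local diffeomorphism, and it sends nearby critical points into
`K`. On `K` the reduced function `V ∘ Φ⁻¹` has a degenerate critical point at `0` and inherits the
PŁ inequality. These are incompatible unless it is locally constant (`eventually_eq_of_degenerate`):
a gradient with small Lipschitz constant satisfies the reverse inequality with a small constant.
Hence the minimizers near `x` are exactly `Φ⁻¹ K` (`exists_sliceChart`).

The dimension could still vary from component to component, so for `d > 1` the set `S` of local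
minimizers is shown to be connected (`isPreconnected_of_descent_map`). All other critical points are
strict local maxima, hence countably many, and their complement is connected. A gradient descent
step `φ x = x - η x • ∇ V x`, with `η` so small that `φ` is injective and decreases `V`, replaces
the gradient flow. A splitting of `S` into two compact pieces would divide this complement into the
two basins and the set of orbits without cluster points. All three are open: a basin because each
level piece of `S` has a trapping neighbourhood, the third by the behaviour of `V` at infinity.

The dimension is below `d`, since a full-dimensional part would be a nonempty compact clopen subset
of `ℝ^d`. For `d = 1` this alone fixes the dimension at `0`. Global minimizers agree with `S` near
each of their points, so they have the same charts. -/

/-! ### Slice charts and embedded submanifolds. -/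

/-- A `C²` diffeomorphism between open subsets of `E` that maps `M` onto a piece of a
`k`-dimensional linear subspace. -/
structure SliceChart {E : Type*} [NormedAddCommGroup E] [InnerProductSpace ℝ E]
    (k : ℕ) (M : Set E) where
  chart : OpenPartialHomeomorph E E
  plane : Submodule ℝ E
  finrank_plane : Module.finrank ℝ plane = k
  contDiffOn : ContDiffOn ℝ 2 chart chart.source
  contDiffOn_symm : ContDiffOn ℝ 2 chart.symm chart.target
  mem_iff : ∀ y ∈ chart.source, y ∈ M ↔ chart y ∈ plane

namespace SliceChart

variable {E : Type*} [NormedAddCommGroup E] [InnerProductSpace ℝ E] [FiniteDimensional ℝ E]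
  {k : ℕ} {M : Set E}

/-- Linear coordinates of the ambient space adapted to the plane of a slice chart. -/
noncomputable def coord (c : SliceChart k M) :
    (EuclideanSpace ℝ (Fin k) × c.planeᗮ) ≃L[ℝ] E :=
  ((LinearEquiv.prodCongr
      (LinearEquiv.ofFinrankEq (EuclideanSpace ℝ (Fin k)) c.plane
        (by rw [c.finrank_plane]; simp)) (LinearEquiv.refl ℝ c.planeᗮ)).trans
    (Submodule.prodEquivOfIsCompl c.plane c.planeᗮ
      (Submodule.isCompl_orthogonal _))).toContinuousLinearEquiv

theorem mem_plane_iff (c : SliceChart k M) (z : E) :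
    z ∈ c.plane ↔ (c.coord.symm z).2 = 0 := by
  obtain ⟨⟨u, v⟩, rfl⟩ := c.coord.surjective z
  rw [c.coord.symm_apply_apply]
  have h : c.coord (u, v) = (LinearEquiv.ofFinrankEq (EuclideanSpace ℝ (Fin k)) c.plane
        (by rw [c.finrank_plane]; simp) u : E) + (v : E) := by
    simp [coord]
  rw [h, Submodule.add_mem_iff_right _ (Submodule.coe_mem _)]
  constructor
  · intro hv
    have : (v : E) ∈ c.plane ⊓ c.planeᗮ := ⟨hv, v.2⟩
    rw [Submodule.inf_orthogonal_eq_bot] at this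
    simpa using this
  · rintro h0
    simp only at h0
    simp [h0]

theorem coord_mem_plane (c : SliceChart k M) (u : EuclideanSpace ℝ (Fin k)) :
    c.coord (u, 0) ∈ c.plane := by
  rw [mem_plane_iff]; simp

theorem coord_fst_of_mem (c : SliceChart k M) {z : E} (hz : z ∈ c.plane) :
    c.coord ((c.coord.symm z).1, 0) = z := by
  rw [← (c.mem_plane_iff z).1 hz]
  simp

theorem symm_mem (c : SliceChart k M) {u : EuclideanSpace ℝ (Fin k)}
    (hu : c.coord (u, 0) ∈ c.chart.target) : c.chart.symm (c.coord (u, 0)) ∈ M := by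
  rw [c.mem_iff _ (c.chart.map_target hu), c.chart.right_inv hu]
  exact c.coord_mem_plane u

open Classical in
/-- The chart of `M` induced by a slice chart. -/
noncomputable def toChart (c : SliceChart k M) (x₀ : M) :
    OpenPartialHomeomorph M (EuclideanSpace ℝ (Fin k)) where
  toFun y := (c.coord.symm (c.chart y)).1
  -- The point `x₀` only provides a value off the target.
  invFun u := if hu : c.coord (u, 0) ∈ c.chart.target then
    ⟨c.chart.symm (c.coord (u, 0)), c.symm_mem hu⟩ else x₀
  source := Subtype.val ⁻¹' c.chart.source
  target := (fun u => c.coord (u, 0)) ⁻¹' c.chart.target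
  map_source' y hy := by
    simp only [mem_preimage] at hy ⊢
    rw [c.coord_fst_of_mem ((c.mem_iff _ hy).1 y.2)]
    exact c.chart.map_source hy
  map_target' u hu := by
    simp only [mem_preimage] at hu ⊢
    rw [dif_pos hu]
    exact c.chart.map_target hu
  left_inv' y hy := by
    simp only [mem_preimage] at hy ⊢
    have h := c.coord_fst_of_mem ((c.mem_iff _ hy).1 y.2)
    rw [dif_pos (by rw [h]; exact c.chart.map_source hy)]
    ext
    simp only [h]
    rw [c.chart.left_inv hy]
  right_inv' u hu := by
    simp only [mem_preimage] at hu ⊢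
    rw [dif_pos hu]
    simp only
    rw [c.chart.right_inv hu]
    simp
  open_source := c.chart.open_source.preimage continuous_subtype_val
  open_target := c.chart.open_target.preimage (by fun_prop)
  continuousOn_toFun := by
    have h : ContinuousOn (fun y : M => c.chart y) (Subtype.val ⁻¹' c.chart.source) :=
      c.chart.continuousOn.comp continuous_subtype_val.continuousOn fun _ h => h
    exact continuous_fst.comp_continuousOn (c.coord.symm.continuous.comp_continuousOn h)
  continuousOn_invFun := by
    rw [IsEmbedding.subtypeVal.continuousOn_iff]
    have h : ContinuousOn (fun u : EuclideanSpace ℝ (Fin k) => c.chart.symm (c.coord (u, 0)))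
        ((fun u => c.coord (u, 0)) ⁻¹' c.chart.target) :=
      c.chart.continuousOn_symm.comp (by fun_prop) fun _ h => h
    refine h.congr fun u hu => ?_
    simp only [mem_preimage] at hu
    simp [hu]

theorem toChart_apply (c : SliceChart k M) (x₀ y : M) :
    c.toChart x₀ y = (c.coord.symm (c.chart y)).1 := rfl

open Classical in
theorem toChart_symm_apply (c : SliceChart k M) (x₀ : M) {u : EuclideanSpace ℝ (Fin k)}
    (hu : u ∈ (c.toChart x₀).target) :
    ((c.toChart x₀).symm u : E) = c.chart.symm (c.coord (u, 0)) := by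
  change ((if hu : c.coord (u, 0) ∈ c.chart.target then
    (⟨c.chart.symm (c.coord (u, 0)), c.symm_mem hu⟩ : M) else x₀ : M) : E) = _
  exact congrArg Subtype.val (dif_pos hu)

theorem toChart_source (c : SliceChart k M) (x₀ : M) :
    (c.toChart x₀).source = Subtype.val ⁻¹' c.chart.source := rfl

theorem contDiffOn_transition (c c' : SliceChart k M) (x₀ x₁ : M) :
    ContDiffOn ℝ 2 (c'.toChart x₁ ∘ (c.toChart x₀).symm)
      ((c.toChart x₀).symm ≫ₕ c'.toChart x₁).source := by
  have h : ContDiffOn ℝ 2 (fun u : EuclideanSpace ℝ (Fin k) =>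
      (c'.coord.symm (c'.chart (c.chart.symm (c.coord (u, 0))))).1)
      ((c.toChart x₀).symm ≫ₕ c'.toChart x₁).source := by
    have h1 : ContDiffOn ℝ 2 (fun u : EuclideanSpace ℝ (Fin k) =>
        c.chart.symm (c.coord (u, 0))) ((c.toChart x₀).symm ≫ₕ c'.toChart x₁).source := by
      refine c.contDiffOn_symm.comp (ContDiff.contDiffOn (by fun_prop)) ?_
      intro u hu
      exact hu.1
    have h2 := c'.contDiffOn.comp h1 (by
      intro u hu
      have := hu.2
      rw [mem_preimage, toChart_source, mem_preimage,
        OpenPartialHomeomorph.symm_symm, c.toChart_symm_apply x₀ hu.1] at this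
      exact this)
    exact contDiff_fst.comp_contDiffOn (c'.coord.symm.contDiff.comp_contDiffOn h2)
  refine h.congr fun u hu => ?_
  rw [Function.comp_apply, toChart_apply, c.toChart_symm_apply x₀ hu.1]

/-- Invariance of dimension: the transition map carries plane points to plane points, through `M`,
so its invertible derivative embeds one plane in the other. -/
theorem le_of_mem {j : ℕ} (c : SliceChart k M) (c' : SliceChart j M) {x : E} (hx : x ∈ M)
    (hc : x ∈ c.chart.source) (hc' : x ∈ c'.chart.source) : k ≤ j := by
  have hd : DifferentiableAt ℝ c.chart x :=
    (c.contDiffOn.contDiffAt (c.chart.open_source.mem_nhds hc)).differentiableAt (by norm_num)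
  have hd' : DifferentiableAt ℝ c'.chart x :=
    (c'.contDiffOn.contDiffAt (c'.chart.open_source.mem_nhds hc')).differentiableAt (by norm_num)
  have hs : DifferentiableAt ℝ c.chart.symm (c.chart x) :=
    (c.contDiffOn_symm.contDiffAt
      (c.chart.open_target.mem_nhds (c.chart.map_source hc))).differentiableAt (by norm_num)
  have hs' : DifferentiableAt ℝ c'.chart.symm (c'.chart x) :=
    (c'.contDiffOn_symm.contDiffAt
      (c'.chart.open_target.mem_nhds (c'.chart.map_source hc'))).differentiableAt (by norm_num)
  set A := (fderiv ℝ c'.chart x).comp (fderiv ℝ c.chart.symm (c.chart x)) with hA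
  have hg : HasFDerivAt (c'.chart ∘ c.chart.symm) A (c.chart x) := by
    refine HasFDerivAt.comp _ ?_ hs.hasFDerivAt
    rw [c.chart.left_inv hc]
    exact hd'.hasFDerivAt
  have hcomp : ∀ (φ : OpenPartialHomeomorph E E) (z : E), z ∈ φ.source →
      DifferentiableAt ℝ φ z → DifferentiableAt ℝ φ.symm (φ z) →
      (fderiv ℝ φ.symm (φ z)).comp (fderiv ℝ φ z) = ContinuousLinearMap.id ℝ E := by
    intro φ z hφ h1 h2
    refine (h2.hasFDerivAt.comp z h1.hasFDerivAt).unique ?_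
    refine (hasFDerivAt_id z).congr_of_eventuallyEq ?_
    filter_upwards [φ.open_source.mem_nhds hφ] with y hy using φ.left_inv hy
  have hcomp' : (fderiv ℝ c.chart x).comp (fderiv ℝ c.chart.symm (c.chart x)) =
      ContinuousLinearMap.id ℝ E := by
    have := hcomp c.chart.symm (c.chart x) (c.chart.map_source hc) hs
      (by rw [c.chart.left_inv hc]; exact hd)
    rwa [c.chart.left_inv hc] at this
  have hinj : Function.Injective A := by
    have : Function.LeftInverse
        ((fderiv ℝ c.chart x).comp (fderiv ℝ c'.chart.symm (c'.chart x))) A := by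
      intro v
      have h1 := DFunLike.congr_fun (hcomp c'.chart x hc' hd' hs')
        (fderiv ℝ c.chart.symm (c.chart x) v)
      have h2 := DFunLike.congr_fun hcomp' v
      simp only [ContinuousLinearMap.comp_apply, ContinuousLinearMap.id_apply, hA] at h1 h2 ⊢
      rw [h1, h2]
    exact this.injective
  have hmap : ∀ v ∈ c.plane, A v ∈ c'.plane := by
    intro v hv
    have hline : HasDerivAt (fun t : ℝ => c.chart x + t • v) v 0 := by
      simpa using ((hasDerivAt_id (0 : ℝ)).smul_const v).const_add (c.chart x)
    have hg0 : HasFDerivAt (c'.chart ∘ c.chart.symm) A (c.chart x + (0 : ℝ) • v) := by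
      simpa using hg
    have h1 := (c'.planeᗮ.orthogonalProjectionOnto.hasFDerivAt).comp_hasDerivAt (0 : ℝ)
      (hg0.comp_hasDerivAt (0 : ℝ) hline)
    have hev : (fun t : ℝ => c'.planeᗮ.orthogonalProjectionOnto
        ((c'.chart ∘ c.chart.symm) (c.chart x + t • v))) =ᶠ[𝓝 0] fun _ => 0 := by
      have hnhds : ∀ᶠ y in 𝓝 (c.chart x), y ∈ c.chart.target ∧
          c.chart.symm y ∈ c'.chart.source := by
        refine Filter.Eventually.and (c.chart.open_target.mem_nhds (c.chart.map_source hc)) ?_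
        refine hs.continuousAt.eventually ?_
        rw [c.chart.left_inv hc]
        exact c'.chart.open_source.mem_nhds hc'
      have ht : Tendsto (fun t : ℝ => c.chart x + t • v) (𝓝 0) (𝓝 (c.chart x)) := by
        simpa using hline.continuousAt.tendsto
      filter_upwards [ht.eventually hnhds] with t ht
      rw [Submodule.orthogonalProjectionOnto_eq_zero_iff, Submodule.orthogonal_orthogonal]
      refine (c'.mem_iff _ ht.2).1 ((c.mem_iff _ (c.chart.map_target ht.1)).2 ?_)
      rw [c.chart.right_inv ht.1]
      exact c.plane.add_mem ((c.mem_iff x hc).1 hx) (c.plane.smul_mem t hv)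
    have h2 := h1.unique ((hasDerivAt_const (0 : ℝ) (0 : c'.planeᗮ)).congr_of_eventuallyEq hev)
    rwa [Submodule.orthogonalProjectionOnto_eq_zero_iff, Submodule.orthogonal_orthogonal] at h2
  have := LinearMap.finrank_le_finrank_of_injective
    (f := (A : E →ₗ[ℝ] E).restrict hmap) (by
      intro v w hvw
      exact Subtype.ext (hinj (congrArg Subtype.val hvw)))
  rwa [c.finrank_plane, c'.finrank_plane] at this

/-- A slice chart of `M` restricts to a slice chart of a set that agrees with `M` on an open
set. -/
def restr {M' : Set E} (c : SliceChart k M) {U : Set E} (hU : IsOpen U)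
    (h : ∀ y ∈ U, y ∈ M' ↔ y ∈ M) : SliceChart k M' where
  chart := c.chart.restrOpen U hU
  plane := c.plane
  finrank_plane := c.finrank_plane
  contDiffOn := c.contDiffOn.mono inter_subset_left
  contDiffOn_symm := c.contDiffOn_symm.mono inter_subset_left
  mem_iff y hy := (h y hy.2).trans (c.mem_iff y hy.1)

end SliceChart

/-- Read in a slice chart and its linear coordinates, the inclusion is `u ↦ (u, 0)`. -/
theorem isC2EmbeddedSubmanifold_of_sliceChart {d k : ℕ} {M : Set (EuclideanSpace ℝ (Fin d))}
    (h : ∀ x ∈ M, ∃ c : SliceChart k M, x ∈ c.chart.source) :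
    IsC2EmbeddedSubmanifold k M := by
  choose c hc using fun x : M => h x x.2
  let cs : ChartedSpace (EuclideanSpace ℝ (Fin k)) M :=
    { atlas := range fun x => (c x).toChart x
      chartAt := fun x => (c x).toChart x
      mem_chart_source := fun x => hc x
      chart_mem_atlas := fun x => mem_range_self x }
  have hM : IsManifold (𝓡 k) 2 M := by
    refine isManifold_of_contDiffOn _ _ _ ?_
    rintro _ _ ⟨x, rfl⟩ ⟨y, rfl⟩
    simpa using (c x).contDiffOn_transition (c y) x y
  refine ⟨cs, hM, ModelWithCorners.Boundaryless.boundary_eq_empty, ?_, IsEmbedding.subtypeVal⟩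
  -- One complement must serve all points, whereas `planeᗮ` depends on the chart; the two are
  -- identified by dimension.
  refine ⟨EuclideanSpace ℝ (Fin (d - k)), inferInstance, inferInstance, fun x => ?_⟩
  have hF : Module.finrank ℝ (c x).planeᗮ =
      Module.finrank ℝ (EuclideanSpace ℝ (Fin (d - k))) := by
    have := (c x).plane.finrank_add_finrank_orthogonal
    rw [(c x).finrank_plane, finrank_euclideanSpace_fin] at this
    rw [finrank_euclideanSpace_fin]
    omega
  refine Manifold.IsImmersionAtOfComplement.trans_F ?_
    (LinearEquiv.ofFinrankEq _ _ hF).toContinuousLinearEquiv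
  refine Manifold.IsImmersionAtOfComplement.mk_of_charts (c x).coord ((c x).toChart x)
    (c x).chart (hc x) (hc x) (IsManifold.chart_mem_maximalAtlas x) ?_ subset_rfl ?_
  · refine OpenPartialHomeomorph.mem_maximalAtlas_of_contMDiffOn _ ?_ ?_
    · exact (c x).contDiffOn.contMDiffOn
    · exact (c x).contDiffOn_symm.contMDiffOn
  · intro u hu
    have hu' : u ∈ ((c x).toChart x).target := by simpa using hu
    have := (c x).toChart_symm_apply x hu'
    simp [this]
    exact (c x).chart.right_inv hu'

/-! ### Degenerate critical points under a PŁ inequality. -/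

/-- One gradient step from `w` lowers `f` by at least `‖f' w‖ ^ 2 / (4 * ε)`, and the result is
still at least `m`. -/
theorem sq_norm_fderiv_le_of_lipschitz {F : Type*} [NormedAddCommGroup F] [InnerProductSpace ℝ F]
    [CompleteSpace F] {f : F → ℝ} {f' : F → F →L[ℝ] ℝ} {r ε m : ℝ} (hε : 0 < ε)
    (hf : ∀ w ∈ Metric.ball (0 : F) (2 * r), HasFDerivAt f (f' w) w)
    (hlip : ∀ w ∈ Metric.ball (0 : F) (2 * r), ∀ z ∈ Metric.ball (0 : F) (2 * r),
      ‖f' w - f' z‖ ≤ ε * ‖w - z‖)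
    (h0 : f' 0 = 0) (hm : ∀ w ∈ Metric.ball (0 : F) (2 * r), m ≤ f w) {w : F}
    (hw : w ∈ Metric.ball (0 : F) r) : ‖f' w‖ ^ 2 ≤ 4 * ε * (f w - m) := by
  have hr : 0 < r := Metric.pos_of_mem_ball hw
  rw [mem_ball_zero_iff] at hw
  have hsub : ∀ z : F, ‖z‖ < 2 * r → z ∈ Metric.ball (0 : F) (2 * r) := fun z hz => by
    rwa [mem_ball_zero_iff]
  have hwb := hsub w (by linarith)
  set g := (InnerProductSpace.toDual ℝ F).symm (f' w) with hg
  have hgn : ‖g‖ = ‖f' w‖ := by simp [hg]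
  have hgw : f' w g = ‖f' w‖ ^ 2 := by
    rw [← hgn, ← real_inner_self_eq_norm_sq, hg, InnerProductSpace.toDual_symm_apply]
  have hgle : ‖g‖ ≤ ε * ‖w‖ := by
    have := hlip w hwb 0 (hsub 0 (by simpa using hr))
    rwa [h0, sub_zero, sub_zero, ← hgn] at this
  -- This step length maximizes the guaranteed decrease, and moves `w` by at most `‖w‖ / 2`, hence
  -- stays in the larger ball.
  set y := w - (1 / (2 * ε)) • g with hy
  have hyw : ‖y - w‖ = 1 / (2 * ε) * ‖g‖ := by
    rw [hy, sub_sub_cancel_left, norm_neg, norm_smul, Real.norm_of_nonneg (by positivity)]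
  have hyn : ‖y‖ < 2 * r := by
    have h1 : ‖y‖ ≤ ‖w‖ + ‖y - w‖ := by
      simpa using norm_add_le w (y - w)
    have h2 : 1 / (2 * ε) * ‖g‖ ≤ 1 / (2 * ε) * (ε * ‖w‖) := by gcongr
    have h3 : 1 / (2 * ε) * (ε * ‖w‖) = ‖w‖ / 2 := by field_simp
    linarith
  have hyb := hsub y hyn
  have hseg : segment ℝ w y ⊆ Metric.ball (0 : F) (2 * r) :=
    (convex_ball _ _).segment_subset hwb hyb
  have hmvt := Convex.norm_image_sub_le_of_norm_hasFDerivWithin_le' (f := f) (f' := f')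
    (φ := f' w) (C := ε * ‖y - w‖) (s := segment ℝ w y) (x := w) (y := y)
    (fun z hz => (hf z (hseg hz)).hasFDerivWithinAt)
    (fun z hz => (hlip z (hseg hz) w hwb).trans (by
      gcongr
      have := norm_sub_le_of_mem_segment hz
      simpa using this))
    (convex_segment w y) (left_mem_segment ℝ w y) (right_mem_segment ℝ w y)
  have hlin : f' w (y - w) = -(1 / (2 * ε) * ‖f' w‖ ^ 2) := by
    rw [hy, sub_sub_cancel_left, map_neg, map_smul, hgw, smul_eq_mul]
  rw [hlin, hyw, hgn] at hmvt
  have h4 := (abs_le.1 hmvt).2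
  have h5 := hm y hyb
  have h6 : ε * (1 / (2 * ε) * ‖f' w‖) * (1 / (2 * ε) * ‖f' w‖) = 1 / (4 * ε) * ‖f' w‖ ^ 2 := by
    field_simp; ring
  have h7 : 1 / (2 * ε) * ‖f' w‖ ^ 2 = 2 * (1 / (4 * ε) * ‖f' w‖ ^ 2) := by field_simp; ring
  have h8 : 1 / (4 * ε) * ‖f' w‖ ^ 2 ≤ f w - m := by linarith
  rw [div_mul_eq_mul_div, one_mul, div_le_iff₀ (by positivity)] at h8
  linarith

/-- A function with a degenerate critical point that satisfies a Polyak-Łojasiewicz inequality is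
locally constant there. -/
theorem eventually_eq_of_degenerate {F : Type*} [NormedAddCommGroup F] [InnerProductSpace ℝ F]
    [CompleteSpace F] {f : F → ℝ} {f' : F → F →L[ℝ] ℝ} {c m : ℝ} (hc : 0 < c)
    (hf : ∀ᶠ w in 𝓝 (0 : F), HasFDerivAt f (f' w) w)
    (hf'' : HasStrictFDerivAt f' (0 : F →L[ℝ] F →L[ℝ] ℝ) 0) (h0 : f' 0 = 0)
    (hm : ∀ᶠ w in 𝓝 (0 : F), m ≤ f w)
    (hPL : ∀ᶠ w in 𝓝 (0 : F), c * (f w - m) ≤ ‖f' w‖ ^ 2) :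
    ∀ᶠ w in 𝓝 (0 : F), f w = m := by
  -- With `ε = c / 8` the reverse inequality has constant `c / 2 < c`, which forces `f w ≤ m`.
  obtain ⟨s, hs, hlip⟩ := hf''.exists_lipschitzOnWith_of_nnnorm_lt (Real.toNNReal (c / 8))
    (by simpa using hc)
  obtain ⟨r, hr, hball⟩ := Metric.eventually_nhds_iff_ball.1 (hf.and (hm.and (hPL.and hs)))
  filter_upwards [Metric.ball_mem_nhds (0 : F) (half_pos hr)] with w hw
  have h2 : 2 * (r / 2) = r := by ring
  have key := sq_norm_fderiv_le_of_lipschitz (f := f) (f' := f') (r := r / 2) (ε := c / 8) (m := m)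
    (by positivity) (fun z hz => (hball z (h2 ▸ hz)).1)
    (fun z hz y hy => by
      have := hlip.norm_sub_le (hball z (h2 ▸ hz)).2.2.2 (hball y (h2 ▸ hy)).2.2.2
      rwa [Real.coe_toNNReal _ (by positivity)] at this)
    h0 (fun z hz => (hball z (h2 ▸ hz)).2.1) hw
  have hb := hball w (Metric.ball_subset_ball (by linarith) hw)
  have h3 := hb.2.2.1
  have h4 : f w - m ≤ 0 := by
    by_contra hcon
    push Not at hcon
    nlinarith [mul_pos hc hcon]
  linarith [hb.2.1]

/-! ### Gradient and Hessian. -/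

section Gradient

variable {E : Type*} [NormedAddCommGroup E] [InnerProductSpace ℝ E] [CompleteSpace E]
  {V : E → ℝ} {x : E}

theorem ContDiffAt.gradient {m n : ℕ∞ω} (hV : ContDiffAt ℝ n V x) (hmn : m + 1 ≤ n) :
    ContDiffAt ℝ m (∇ V) x :=
  (InnerProductSpace.toDual ℝ E).symm.contDiff.contDiffAt.comp x (hV.fderiv_right hmn)

theorem inner_fderiv_gradient (hV : ContDiffAt ℝ 2 V x) (u v : E) :
    inner ℝ (fderiv ℝ (∇ V) x u) v = fderiv ℝ (fderiv ℝ V) x u v := by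
  have hd : DifferentiableAt ℝ (fderiv ℝ V) x :=
    (hV.fderiv_right (m := 1) (by norm_num)).differentiableAt (by norm_num)
  have hG : DifferentiableAt ℝ (∇ V) x :=
    (hV.gradient (m := 1) (by norm_num)).differentiableAt (by norm_num)
  have h1 : HasFDerivAt (fun y => inner ℝ v (∇ V y))
      ((innerSL ℝ v).comp (fderiv ℝ (∇ V) x)) x :=
    (innerSL ℝ v).hasFDerivAt.comp x hG.hasFDerivAt
  have h2 : HasFDerivAt (fun y => fderiv ℝ V y v)
      ((ContinuousLinearMap.apply ℝ ℝ v).comp (fderiv ℝ (fderiv ℝ V) x)) x :=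
    (ContinuousLinearMap.apply ℝ ℝ v).hasFDerivAt.comp x hd.hasFDerivAt
  have h3 : (fun y => inner ℝ v (∇ V y)) = fun y => fderiv ℝ V y v := by
    ext y
    rw [real_inner_comm, inner_gradient_left]
  rw [h3] at h1
  rw [real_inner_comm]
  exact DFunLike.congr_fun (h1.unique h2) u

theorem inner_fderiv_gradient_comm (hV : ContDiffAt ℝ 2 V x) (u v : E) :
    inner ℝ (fderiv ℝ (∇ V) x u) v = inner ℝ u (fderiv ℝ (∇ V) x v) := by
  rw [inner_fderiv_gradient hV, ← real_inner_comm, inner_fderiv_gradient hV]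
  exact (hV.isSymmSndFDerivAt (by simp)) u v

end Gradient

theorem HasStrictFDerivAt.eventually_norm_sub_lt {F G : Type*} [NormedAddCommGroup F]
    [NormedSpace ℝ F] [NormedAddCommGroup G] [NormedSpace ℝ G] {b : F → G} {b' : F →L[ℝ] G} {x : F}
    (h : HasStrictFDerivAt b b' x) {ε : ℝ} (hε : 0 < ε) :
    ∀ᶠ w in 𝓝 x, ‖b w - b x‖ < ε := by
  filter_upwards [Metric.tendsto_nhds.1 h.continuousAt.tendsto ε hε] with w hw
  rwa [← dist_eq_norm]

/-! ### Lyapunov–Schmidt reduction at a minimizer. -/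

section Straighten

variable {E : Type*} [NormedAddCommGroup E] [InnerProductSpace ℝ E] [FiniteDimensional ℝ E]

/-- A local diffeomorphism that straightens the set where the component of `G` orthogonal to
`K = ker DG(x)` vanishes. -/
theorem exists_straightening {G : E → E} {x : E} (hG : ContDiffAt ℝ 2 G x) (hGx : G x = 0)
    (hsymm : ∀ u v, inner ℝ (fderiv ℝ G x u) v = inner ℝ u (fderiv ℝ G x v)) :
    ∃ (K : Submodule ℝ E) (Φ : OpenPartialHomeomorph E E), x ∈ Φ.source ∧ Φ x = 0 ∧
      (∀ w ∈ K, fderiv ℝ G x w = 0) ∧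
      (∀ y, Φ y = K.starProjection (y - x) + (G y - K.starProjection (G y))) ∧
      ContDiffAt ℝ 2 Φ x ∧ ContDiffAt ℝ 2 Φ.symm 0 ∧
      ∀ w ∈ K, fderiv ℝ Φ.symm 0 w = w := by
  set H := fderiv ℝ G x with hH
  set K : Submodule ℝ E := H.toLinearMap.ker with hK
  have hKH : ∀ w ∈ K, H w = 0 := fun w hw => hw
  have hHK : ∀ v, H v ∈ Kᗮ := by
    intro v
    rw [Submodule.mem_orthogonal]
    intro u hu
    rw [← hsymm, hKH u hu, inner_zero_left]
  set P := K.starProjection with hP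
  have hPmem : ∀ v, P v ∈ K := K.starProjection_apply_mem
  have hPH : ∀ v, P (H v) = 0 := fun v =>
    (K.starProjection_apply_eq_zero_iff).2 (hHK v)
  have hPK : ∀ v ∈ K, P v = v := fun v hv => K.starProjection_eq_self_iff.2 hv
  set Ψ : E → E := fun y => P (y - x) + (G y - P (G y)) with hΨ
  have hΨ2 : ContDiffAt ℝ 2 Ψ x := by
    refine ContDiffAt.add ?_ (hG.sub ?_)
    · exact P.contDiff.contDiffAt.comp x (contDiffAt_id.sub contDiffAt_const)
    · exact P.contDiff.contDiffAt.comp x hG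
  have hGd : HasFDerivAt G H x := (hG.differentiableAt (by norm_num)).hasFDerivAt
  -- The range of `H` is orthogonal to `K`, so `P v + H v = 0` makes both terms vanish: `v` is then
  -- both in `K` and orthogonal to it.
  have hinj : Function.Injective (P + H : E →L[ℝ] E) := by
    rw [injective_iff_map_eq_zero]
    intro v hv
    have hv' : P v + H v = 0 := hv
    have h1 : P v = 0 := by
      have : P (P v + H v) = 0 := by rw [hv', map_zero]
      rwa [map_add, hPH, add_zero, hPK _ (hPmem v)] at this
    have h2 : H v = 0 := by rwa [h1, zero_add] at hv'
    rw [← hPK v h2, h1]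
  set L : E ≃L[ℝ] E :=
    (LinearEquiv.ofInjectiveEndo ((P + H : E →L[ℝ] E) : E →ₗ[ℝ] E) hinj).toContinuousLinearEquiv
    with hL
  have hLapply : ∀ v, L v = P v + H v := fun v => rfl
  have hΨd : HasFDerivAt Ψ (L : E →L[ℝ] E) x := by
    have h1 : HasFDerivAt Ψ (P.comp (ContinuousLinearMap.id ℝ E) + (H - P.comp H)) x :=
      (P.hasFDerivAt.comp x ((hasFDerivAt_id x).sub_const x)).add
        (hGd.sub (P.hasFDerivAt.comp x hGd))
    convert h1 using 1
    ext v
    simp [hLapply, hPH]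
  set Φ := hΨ2.toOpenPartialHomeomorph Ψ hΨd (by norm_num) with hΦ
  have hcoe : ∀ y, Φ y = Ψ y := fun y => rfl
  have hxs : x ∈ Φ.source := hΨ2.mem_toOpenPartialHomeomorph_source hΨd (by norm_num)
  have hΦx : Φ x = 0 := by rw [hcoe]; simp [hΨ, hGx]
  have h0t : (0 : E) ∈ Φ.target := hΦx ▸ Φ.map_source hxs
  have hsx : Φ.symm 0 = x := by rw [← hΦx, Φ.left_inv hxs]
  have hΦd : HasFDerivAt Φ (L : E →L[ℝ] E) (Φ.symm 0) := by rw [hsx]; exact hΨd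
  refine ⟨K, Φ, hxs, hΦx, hKH, hcoe, hΨ2, ?_, ?_⟩
  · refine Φ.contDiffAt_symm h0t hΦd ?_
    rw [hsx]
    exact hΨ2
  · intro w hw
    have h1 : HasFDerivAt Φ.symm (L.symm : E →L[ℝ] E) 0 := Φ.hasFDerivAt_symm h0t hΦd
    rw [h1.fderiv]
    change L.symm w = w
    rw [ContinuousLinearEquiv.symm_apply_eq, hLapply, hPK w hw, hKH w hw, add_zero]

/-- Points of `M` are critical, so `Φ` sends them into `K`; conversely `V` is constantly `m` on `Φ⁻¹
K` near `x`, because the reduced function is degenerate and inherits the PŁ inequality. -/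
theorem exists_sliceChart {V : E → ℝ} {x : E} {M : Set E} {m ν : ℝ} (hV : ContDiffAt ℝ 3 V x)
    (hν : 0 < ν) (hx : x ∈ M) (hM : ∀ᶠ y in 𝓝 x, y ∈ M ↔ V y = m)
    (hmin : ∀ᶠ y in 𝓝 x, m ≤ V y) (hPL : ∀ᶠ y in 𝓝 x, ν * (V y - m) ≤ ‖∇ V y‖ ^ 2) :
    ∃ k, ∃ c : SliceChart k M, x ∈ c.chart.source := by
  have hG : ContDiffAt ℝ 2 (∇ V) x := hV.gradient (by norm_num)
  have hcrit : ∀ᶠ y in 𝓝 x, y ∈ M → ∇ V y = 0 := by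
    filter_upwards [hM, hmin.eventually_nhds] with y hy hy' hyM
    have hloc : IsLocalMin V y := by
      filter_upwards [hy'] with z hz
      rw [hy.1 hyM]
      exact hz
    rw [gradient, hloc.fderiv_eq_zero, map_zero]
  have hGx : ∇ V x = 0 := hcrit.self_of_nhds hx
  obtain ⟨K, Φ, hxs, hΦx, hK, hΦ, hΦ2, hΦs2, hΦK⟩ := exists_straightening hG hGx
    (inner_fderiv_gradient_comm (hV.of_le (by norm_num)))
  have h0t : (0 : E) ∈ Φ.target := hΦx ▸ Φ.map_source hxs
  have hsx : Φ.symm 0 = x := by rw [← hΦx, Φ.left_inv hxs]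
  have hflat : ∀ᶠ w : K in 𝓝 0, V (Φ.symm w) = m := by
    have hcont : Tendsto (fun w : K => Φ.symm w) (𝓝 0) (𝓝 x) := by
      have h1 : Tendsto (fun w : K => (w : E)) (𝓝 0) (𝓝 0) :=
        continuous_subtype_val.tendsto' _ _ rfl
      have h2 := hΦs2.continuousAt.tendsto
      rw [hsx] at h2
      exact h2.comp h1
    have hval : Tendsto (fun w : K => (w : E)) (𝓝 0) (𝓝 0) :=
      continuous_subtype_val.tendsto' _ _ rfl
    -- The reduced derivative is the pairing of `a w` with `b w`. Both `a` and its derivative vanish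
    -- at `0`, so by the product rule the reduced Hessian is zero.
    set a : K → E := fun w => ∇ V (Φ.symm w) with ha
    set b : K → K →L[ℝ] E := fun w => (fderiv ℝ Φ.symm w).comp K.subtypeL with hb
    have hsub : HasStrictFDerivAt (fun w : K => (w : E)) K.subtypeL 0 :=
      K.subtypeL.hasStrictFDerivAt
    have ha' : HasStrictFDerivAt a (0 : K →L[ℝ] E) 0 := by
      have h1 : HasStrictFDerivAt (∇ V) (fderiv ℝ (∇ V) x) (Φ.symm ((0 : K) : E)) := by
        rw [Submodule.coe_zero, hsx]
        exact hG.hasStrictFDerivAt (by norm_num)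
      have h2 : HasStrictFDerivAt Φ.symm (fderiv ℝ Φ.symm 0) ((0 : K) : E) :=
        hΦs2.hasStrictFDerivAt (by norm_num)
      have h3 := h1.comp (0 : K) (h2.comp (0 : K) hsub)
      have h4 : (fderiv ℝ (∇ V) x).comp ((fderiv ℝ Φ.symm 0).comp K.subtypeL) = 0 := by
        ext w
        simp [hΦK w w.2, hK w w.2]
      rw [h4] at h3
      exact h3
    have hb' : ∃ b' : K →L[ℝ] K →L[ℝ] E, HasStrictFDerivAt b b' 0 := by
      have h1 : HasStrictFDerivAt (fderiv ℝ Φ.symm) (fderiv ℝ (fderiv ℝ Φ.symm) 0)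
          ((0 : K) : E) :=
        (hΦs2.fderiv_right (m := 1) (by norm_num)).hasStrictFDerivAt (by norm_num)
      exact ⟨_, (h1.comp (0 : K) hsub).clm_comp (hasStrictFDerivAt_const _ _)⟩
    obtain ⟨b', hb'⟩ := hb'
    have ha0 : a 0 = 0 := by simp [ha, hsx, hGx]
    refine eventually_eq_of_degenerate (f := fun w : K => V (Φ.symm w))
      (f' := fun w => (innerSL ℝ (a w)).comp (b w)) (c := ν / 4) (by positivity) ?_ ?_ ?_ ?_ ?_
    · have h1 : ∀ᶠ w : K in 𝓝 0, DifferentiableAt ℝ Φ.symm (w : E) :=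
        hval.eventually ((hΦs2.eventually (by simp)).mono
          fun z hz => hz.differentiableAt (by norm_num))
      have h2 : ∀ᶠ w : K in 𝓝 0, DifferentiableAt ℝ V (Φ.symm w) :=
        hcont.eventually ((hV.eventually (by simp)).mono
          fun z hz => hz.differentiableAt (by norm_num))
      filter_upwards [h1, h2] with w h1 h2
      have h3 := h2.hasFDerivAt.comp w (h1.hasFDerivAt.comp w K.subtypeL.hasFDerivAt)
      have h4 : (innerSL ℝ (a w)).comp (b w) = (fderiv ℝ V (Φ.symm w)).comp
          ((fderiv ℝ Φ.symm w).comp K.subtypeL) := by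
        ext v
        simp [ha, hb, inner_gradient_left]
      rw [h4]
      exact h3
    · have h1 := ((innerSL ℝ : E →L[ℝ] E →L[ℝ] ℝ).hasStrictFDerivAt.comp (0 : K) ha').clm_comp hb'
      convert h1 using 1
      refine ContinuousLinearMap.ext fun v => ContinuousLinearMap.ext fun u => ?_
      simp [ha0]
    · ext v
      simp [ha0]
    · exact hcont.eventually hmin
    · have hbc : ∀ᶠ w : K in 𝓝 0, ‖b w - b 0‖ < 1 / 2 := by
        exact HasStrictFDerivAt.eventually_norm_sub_lt (F := K) (G := K →L[ℝ] E) hb' (by norm_num)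
      filter_upwards [hbc, hcont.eventually hPL,
        hval.eventually (Φ.open_target.mem_nhds h0t)] with w hw1 hw2 hw3
      -- `Φ y = w ∈ K` forces the component of `∇ V y` orthogonal to `K` to vanish.
      have hmem : a w ∈ K := by
        have h1 := hΦ (Φ.symm w)
        rw [Φ.right_inv hw3] at h1
        have h2 : a w = w - K.starProjection (Φ.symm w - x) + K.starProjection (a w) := by
          simp only [ha]
          nth_rewrite 2 [h1]
          abel
        rw [h2]
        exact K.add_mem (K.sub_mem w.2 (K.starProjection_apply_mem _))
          (K.starProjection_apply_mem _)
      set u : K := ⟨a w, hmem⟩ with hu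
      have hun : ‖u‖ = ‖a w‖ := rfl
      have hb0 : b 0 u = a w := by
        simp only [hb, ContinuousLinearMap.comp_apply, Submodule.coe_zero]
        exact hΦK _ hmem
      have h1 : ((innerSL ℝ (a w)).comp (b w)) u =
          ‖a w‖ ^ 2 + inner ℝ (a w) ((b w - b 0) u) := by
        rw [sub_apply, hb0, inner_sub_right, real_inner_self_eq_norm_sq]
        simp
      have h2 : |inner ℝ (a w) ((b w - b 0) u)| ≤ 1 / 2 * ‖a w‖ ^ 2 := by
        calc |inner ℝ (a w) ((b w - b 0) u)| ≤ ‖a w‖ * ‖(b w - b 0) u‖ :=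
              abs_real_inner_le_norm _ _
          _ ≤ ‖a w‖ * (1 / 2 * ‖a w‖) := by
              gcongr
              exact ((b w - b 0).le_opNorm u).trans (by rw [hun]; gcongr)
          _ = 1 / 2 * ‖a w‖ ^ 2 := by ring
      have h3 : ((innerSL ℝ (a w)).comp (b w)) u ≤
          ‖(innerSL ℝ (a w)).comp (b w)‖ * ‖a w‖ := by
        rw [← hun]
        exact (le_abs_self _).trans (((innerSL ℝ (a w)).comp (b w)).le_opNorm u)
      -- Since `b 0` is the inclusion of `K` and `a w ∈ K`, testing on `a w` itself loses at most
      -- half the gradient; squaring gives the constant `ν / 4`.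
      have h4 : ‖a w‖ / 2 ≤ ‖(innerSL ℝ (a w)).comp (b w)‖ := by
        rcases (norm_nonneg (a w)).eq_or_lt with h0 | h0
        · rw [← h0, zero_div]; exact ContinuousLinearMap.opNorm_nonneg _
        · have h5 := (abs_le.1 h2).1
          by_contra hcon
          push Not at hcon
          nlinarith [mul_lt_mul_of_pos_right hcon h0]
      have h5 : (‖a w‖ / 2) ^ 2 ≤ ‖(innerSL ℝ (a w)).comp (b w)‖ ^ 2 := by gcongr
      have h6 : ν * (V (Φ.symm w) - m) ≤ ‖a w‖ ^ 2 := hw2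
      nlinarith
  have hflat' : ∀ᶠ y in 𝓝 x, Φ y ∈ K → V y = m := by
    obtain ⟨r, hr, hball⟩ := Metric.eventually_nhds_iff.1 hflat
    have h1 : ∀ᶠ y in 𝓝 x, dist (Φ y) 0 < r := by
      have := hΦ2.continuousAt.tendsto
      rw [hΦx] at this
      exact this.eventually (Metric.ball_mem_nhds _ hr)
    filter_upwards [h1, Φ.open_source.mem_nhds hxs] with y hy hys hyK
    have h2 := hball (y := (⟨Φ y, hyK⟩ : K)) hy
    simpa [Φ.left_inv hys] using h2
  have hall : ∀ᶠ y in 𝓝 x, ContDiffAt ℝ 2 Φ y ∧ ContDiffAt ℝ 2 Φ.symm (Φ y) ∧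
      (y ∈ M ↔ Φ y ∈ K) := by
    have h1 : ∀ᶠ y in 𝓝 x, ContDiffAt ℝ 2 Φ.symm (Φ y) := by
      have := hΦ2.continuousAt.tendsto
      rw [hΦx] at this
      exact this.eventually (hΦs2.eventually (by simp))
    filter_upwards [hΦ2.eventually (by simp), h1, hflat', hM, hcrit] with y h1 h2 h3 h4 h5
    refine ⟨h1, h2, fun hy => ?_, fun hy => h4.2 (h3 hy)⟩
    rw [hΦ, h5 hy]
    rw [map_zero, sub_zero, add_zero]
    exact K.starProjection_apply_mem _
  obtain ⟨U, hU, hUo, hxU⟩ := eventually_nhds_iff.1 hall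
  refine ⟨_, ⟨Φ.restrOpen U hUo, K, rfl, ?_, ?_, ?_⟩, hxs, hxU⟩
  · exact fun y hy => (hU y hy.2).1.contDiffWithinAt
  · intro z hz
    have h1 := (hU _ hz.2).2.1
    rw [Φ.right_inv hz.1] at h1
    exact h1.contDiffWithinAt
  · exact fun y hy => (hU y hy.2).2.2

end Straighten

/-! ### The descent map. -/

/-- Below a positive antitone function `u` there is a positive function whose variation on
`[r, r']` is controlled by `u r`. -/
theorem exists_slowly_varying_minorant {u : ℝ → ℝ} (hu : Antitone u) (hpos : ∀ r, 0 < u r) :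
    ∃ h : ℝ → ℝ, (∀ r, 0 < h r) ∧ (∀ r, h r ≤ u r) ∧
      ∀ r r', r ≤ r' → |h r - h r'| ≤ u r * (r' - r) := by
  have hint : ∀ a b, IntervalIntegrable u MeasureTheory.volume a b :=
    fun a b => hu.intervalIntegrable
  have hup : ∀ a b c, a ≤ b → c ≤ a → ∫ s in a..b, u s ≤ u c * (b - a) := by
    intro a b c hab hca
    have := intervalIntegral.integral_mono_on hab (hint a b)
      (intervalIntegrable_const (c := u c)) (fun s hs => hu (hca.trans hs.1))
    rwa [intervalIntegral.integral_const, smul_eq_mul, mul_comm] at this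
  have hnn : ∀ a b, a ≤ b → 0 ≤ ∫ s in a..b, u s := fun a b hab =>
    intervalIntegral.integral_nonneg hab fun s _ => (hpos s).le
  -- Averaging over unit windows: `h r - h r'` is the difference of the integrals over `[r, r']` and
  -- `[r + 1, r' + 1]`, both between `0` and `u r * (r' - r)`.
  refine ⟨fun r => ∫ s in r..(r + 1), u s, fun r => ?_, fun r => ?_, fun r r' hr => ?_⟩
  · exact intervalIntegral.intervalIntegral_pos_of_pos (hint _ _) hpos (by linarith)
  · simpa using hup r (r + 1) r (by linarith) le_rfl
  · have h1 := intervalIntegral.integral_interval_sub_interval_comm (μ := MeasureTheory.volume)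
      (hint r (r + 1)) (hint r' (r' + 1)) (hint r r')
    simp only
    rw [h1, abs_le]
    have h2 := hup r r' r hr le_rfl
    have h3 := hnn r r' hr
    have h4 := hup (r + 1) (r' + 1) r (by linarith) (by linarith)
    have h5 := hnn (r + 1) (r' + 1) (by linarith)
    constructor <;> linarith

/-- A gradient descent step with variable step size `η`, small enough for the step to be a
contraction and for the function to decrease. -/
theorem exists_descent_step {E : Type*} [NormedAddCommGroup E] [InnerProductSpace ℝ E]
    [FiniteDimensional ℝ E] {V : E → ℝ} (hV : ContDiff ℝ 2 V) :
    ∃ η : E → ℝ, (∀ x, 0 < η x) ∧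
      (∀ x y, ‖η x • ∇ V x - η y • ∇ V y‖ ≤ 1 / 2 * ‖x - y‖) ∧
      ∀ x, V (x - η x • ∇ V x) ≤ V x - η x / 2 * ‖∇ V x‖ ^ 2 := by
  have hG : ContDiff ℝ 1 (∇ V) :=
    contDiff_iff_contDiffAt.2 fun x => hV.contDiffAt.gradient (by norm_num)
  have hGd : Differentiable ℝ (∇ V) := hG.differentiable (by norm_num)
  have hVd : Differentiable ℝ V := hV.differentiable (by norm_num)
  set q : E → ℝ := fun x => ‖∇ V x‖ + ‖fderiv ℝ (∇ V) x‖ with hq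
  have hqc : Continuous q := hG.continuous.norm.add (hG.continuous_fderiv (by norm_num)).norm
  -- The maximum with `0` keeps the ball nonempty, so that `g` is monotone on all of `ℝ`.
  set g : ℝ → ℝ := fun r => sSup (q '' Metric.closedBall 0 (max r 0)) with hg
  have hbdd : ∀ r, BddAbove (q '' Metric.closedBall (0 : E) r) := fun r =>
    (isCompact_closedBall 0 r).bddAbove_image hqc.continuousOn
  have hqg : ∀ (x : E) r, ‖x‖ ≤ r → q x ≤ g r := fun x r hx =>
    le_csSup (hbdd _) ⟨x, by simp [hx], rfl⟩
  have hgmono : Monotone g := fun r s hrs => csSup_le_csSup (hbdd _)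
    ((Metric.nonempty_closedBall.2 (le_max_right _ _)).image _)
    (image_mono (Metric.closedBall_subset_closedBall (max_le_max_right _ hrs)))
  have hq0 : ∀ x, 0 ≤ q x := fun x => by positivity
  have hg0 : ∀ r, 0 ≤ g r := fun r => Real.sSup_nonneg (by rintro _ ⟨x, _, rfl⟩; exact hq0 x)
  have hlip : ∀ r, ∀ x y : E, ‖x‖ ≤ r → ‖y‖ ≤ r → ‖∇ V x - ∇ V y‖ ≤ g r * ‖x - y‖ := by
    intro r x y hx hy
    refine (convex_closedBall (0 : E) r).norm_image_sub_le_of_norm_fderiv_le (𝕜 := ℝ)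
      (fun z _ => hGd z) (fun z hz => ?_) (by simpa using hy) (by simpa using hx)
    refine le_trans ?_ (hqg z r (by simpa using hz))
    simp [hq]
  obtain ⟨h, hpos, hle, hvar⟩ := exists_slowly_varying_minorant
    -- The shift by `1` covers the whole descent segment, whose length is at most `1`.
    (u := fun r => 1 / (8 * (1 + g (r + 1))))
    (fun r s hrs => by
      have := hg0 (r + 1)
      have := hgmono (by linarith : r + 1 ≤ s + 1)
      simp only
      gcongr)
    (fun r => by have := hg0 (r + 1); positivity)
  have hug : ∀ r, 1 / (8 * (1 + g (r + 1))) * g (r + 1) ≤ 1 / 8 := by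
    intro r
    have := hg0 (r + 1)
    rw [div_mul_eq_mul_div, one_mul, div_le_div_iff₀ (by positivity) (by norm_num)]
    linarith
  have hug' : ∀ r, 1 / (8 * (1 + g (r + 1))) * g r ≤ 1 / 8 := by
    intro r
    have h0 := hg0 (r + 1)
    refine le_trans ?_ (hug r)
    have := hgmono (by linarith : r ≤ r + 1)
    gcongr
  have hgrad : ∀ x, ‖∇ V x‖ ≤ g ‖x‖ := fun x => by
    refine le_trans ?_ (hqg x _ le_rfl)
    simp [hq]
  have hcontr : ∀ x y : E, ‖x‖ ≤ ‖y‖ →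
      ‖h ‖x‖ • ∇ V x - h ‖y‖ • ∇ V y‖ ≤ 1 / 2 * ‖x - y‖ := by
    intro x y hxy
    have e : h ‖x‖ • ∇ V x - h ‖y‖ • ∇ V y =
        (h ‖x‖ - h ‖y‖) • ∇ V x + h ‖y‖ • (∇ V x - ∇ V y) := by
      rw [sub_smul, smul_sub]; abel
    have hd : ‖y‖ - ‖x‖ ≤ ‖x - y‖ := by
      rw [norm_sub_rev]; exact norm_sub_norm_le y x
    have h0 := hg0 (‖x‖ + 1)
    have h0' := hg0 (‖y‖ + 1)
    have h1 : ‖(h ‖x‖ - h ‖y‖) • ∇ V x‖ ≤ 1 / 8 * ‖x - y‖ := by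
      rw [norm_smul, Real.norm_eq_abs]
      calc |h ‖x‖ - h ‖y‖| * ‖∇ V x‖
          ≤ (1 / (8 * (1 + g (‖x‖ + 1))) * ‖x - y‖) * g ‖x‖ := by
            refine mul_le_mul ((hvar _ _ hxy).trans ?_) (hgrad x) (norm_nonneg _)
              (by positivity)
            gcongr
        _ = (1 / (8 * (1 + g (‖x‖ + 1))) * g ‖x‖) * ‖x - y‖ := by ring
        _ ≤ 1 / 8 * ‖x - y‖ := by
            have := hug' ‖x‖
            gcongr
    have h2 : ‖h ‖y‖ • (∇ V x - ∇ V y)‖ ≤ 1 / 8 * ‖x - y‖ := by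
      rw [norm_smul, Real.norm_of_nonneg (hpos _).le]
      calc h ‖y‖ * ‖∇ V x - ∇ V y‖
          ≤ 1 / (8 * (1 + g (‖y‖ + 1))) * (g ‖y‖ * ‖x - y‖) :=
            mul_le_mul (hle _) (hlip _ x y hxy le_rfl) (norm_nonneg _) (by positivity)
        _ = (1 / (8 * (1 + g (‖y‖ + 1))) * g ‖y‖) * ‖x - y‖ := by ring
        _ ≤ 1 / 8 * ‖x - y‖ := by
            have := hug' ‖y‖
            gcongr
    rw [e]
    have h3 := norm_add_le ((h ‖x‖ - h ‖y‖) • ∇ V x) (h ‖y‖ • (∇ V x - ∇ V y))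
    have h4 := norm_nonneg (x - y)
    linarith
  refine ⟨fun x => h ‖x‖, fun x => hpos _, fun x y => ?_, fun x => ?_⟩
  · rcases le_total ‖x‖ ‖y‖ with hxy | hxy
    · exact hcontr x y hxy
    · rw [norm_sub_rev, norm_sub_rev x y]
      exact hcontr y x hxy
  · simp only
    set t := h ‖x‖ with ht
    have h0 := hg0 (‖x‖ + 1)
    have ht0 : 0 < t := hpos _
    have htg : t * g (‖x‖ + 1) ≤ 1 / 8 :=
      (mul_le_mul_of_nonneg_right (hle _) h0).trans (hug _)
    have hstep : ‖t • ∇ V x‖ ≤ 1 := by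
      rw [norm_smul, Real.norm_of_nonneg ht0.le]
      have h1 : t * ‖∇ V x‖ ≤ t * g (‖x‖ + 1) := by
        have := (hgrad x).trans (hgmono (by linarith : ‖x‖ ≤ ‖x‖ + 1))
        gcongr
      linarith
    have hmem : ∀ z ∈ segment ℝ x (x - t • ∇ V x), ‖z - x‖ ≤ ‖t • ∇ V x‖ := by
      intro z hz
      have := norm_sub_le_of_mem_segment hz
      simpa using this
    have hmvt := Convex.norm_image_sub_le_of_norm_hasFDerivWithin_le' (f := V)
      (f' := fderiv ℝ V) (φ := fderiv ℝ V x) (C := g (‖x‖ + 1) * ‖t • ∇ V x‖)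
      (s := segment ℝ x (x - t • ∇ V x)) (x := x) (y := x - t • ∇ V x)
      (fun z _ => (hVd z).hasFDerivAt.hasFDerivWithinAt)
      (fun z hz => by
        have hz1 : ‖z‖ ≤ ‖x‖ + 1 := by
          have := norm_add_le x (z - x)
          rw [add_sub_cancel] at this
          linarith [hmem z hz]
        have h1 : ‖fderiv ℝ V z - fderiv ℝ V x‖ = ‖∇ V z - ∇ V x‖ := by
          simp only [gradient, ← map_sub, LinearIsometryEquiv.norm_map]
        rw [h1]
        refine (hlip _ z x hz1 (by linarith)).trans ?_
        have := hmem z hz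
        gcongr)
      (convex_segment _ _) (left_mem_segment ℝ _ _) (right_mem_segment ℝ _ _)
    have e1 : fderiv ℝ V x (x - t • ∇ V x - x) = -(t * ‖∇ V x‖ ^ 2) := by
      rw [sub_sub_cancel_left, map_neg, map_smul, smul_eq_mul, ← inner_gradient_left,
        real_inner_self_eq_norm_sq]
    rw [e1, sub_sub_cancel_left, norm_neg, norm_smul, Real.norm_of_nonneg ht0.le] at hmvt
    have h2 := (abs_le.1 hmvt).2
    have h3 : g (‖x‖ + 1) * (t * ‖∇ V x‖) * (t * ‖∇ V x‖) =
        (t * g (‖x‖ + 1)) * (t * ‖∇ V x‖ ^ 2) := by ring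
    have h4 : (t * g (‖x‖ + 1)) * (t * ‖∇ V x‖ ^ 2) ≤ 1 / 8 * (t * ‖∇ V x‖ ^ 2) := by
      gcongr
    have h5 : 0 ≤ t * ‖∇ V x‖ ^ 2 := by positivity
    linarith

/-! ### Cluster points, basins and escaping orbits. -/

theorem iterate_value_antitone {X : Type*} {φ : X → X} {V : X → ℝ}
    (hle : ∀ x, V (φ x) ≤ V x) (x : X) :
    Antitone fun n => V (φ^[n] x) :=
  antitone_nat_of_succ_le fun n => by
    rw [Function.iterate_succ_apply']
    exact hle _

section Dynamics

variable {X : Type*} [MetricSpace X] {φ : X → X} {V : X → ℝ}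

theorem value_le_of_mapClusterPt (hV : Continuous V) (hle : ∀ x, V (φ x) ≤ V x) {x p : X}
    (hp : MapClusterPt p atTop fun n => φ^[n] x) (n : ℕ) : V p ≤ V (φ^[n] x) := by
  by_contra hcon
  push Not at hcon
  have h1 : {z | V (φ^[n] x) < V z} ∈ 𝓝 p :=
    (isOpen_lt continuous_const hV).mem_nhds hcon
  obtain ⟨k, hk, hnk⟩ := ((hp.frequently h1).and_eventually (eventually_ge_atTop n)).exists
  exact absurd (iterate_value_antitone hle x hnk) (not_le.2 hk)

theorem fixed_of_mapClusterPt (hφ : Continuous φ) (hV : Continuous V)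
    (hle : ∀ x, V (φ x) ≤ V x) (hlt : ∀ x, φ x ≠ x → V (φ x) < V x) {x p : X}
    (hp : MapClusterPt p atTop fun n => φ^[n] x) : φ p = p := by
  by_contra hcon
  have h1 : {z | V (φ z) < V p} ∈ 𝓝 p :=
    (isOpen_lt (hV.comp hφ) continuous_const).mem_nhds (hlt p hcon)
  obtain ⟨k, hk⟩ := (hp.frequently h1).exists
  have h2 := value_le_of_mapClusterPt hV hle hp (k + 1)
  rw [Function.iterate_succ_apply'] at h2
  exact absurd h2 (not_le.2 hk)

/-- Values along the orbit never fall below `V p`, so an orbit entering a neighbourhood where `p` is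
the strict maximum is already at `p`; injectivity carries this back to `x`. -/
theorem eq_of_mapClusterPt_of_strict_max (hφ : Continuous φ) (hinj : Function.Injective φ)
    (hV : Continuous V) (hle : ∀ x, V (φ x) ≤ V x) (hlt : ∀ x, φ x ≠ x → V (φ x) < V x) {x p : X}
    (hp : MapClusterPt p atTop fun n => φ^[n] x) (hmax : ∀ᶠ y in 𝓝 p, y ≠ p → V y < V p) :
    x = p := by
  have hfix := fixed_of_mapClusterPt hφ hV hle hlt hp
  obtain ⟨k, hk⟩ := (hp.frequently hmax).exists
  have h1 : φ^[k] x = p := by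
    by_contra hcon
    exact absurd (value_le_of_mapClusterPt hV hle hp k) (not_le.2 (hk hcon))
  refine hinj.iterate k ?_
  rw [h1, Function.iterate_fixed hfix]

/-- A compact set of fixed points that is a strict minimum of `V` has a trapping neighbourhood. -/
theorem exists_trapping_neighbourhood [ProperSpace X] (hV : Continuous V)
    (hle : ∀ x, V (φ x) ≤ V x)
    (hstep : ∀ p, φ p = p → ∀ x, dist (φ x) x ≤ 1 / 2 * dist x p) {K O : Set X} {c : ℝ}
    (hK : IsCompact K) (hKne : K.Nonempty) (hO : IsOpen O) (hKO : K ⊆ O)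
    (hfix : ∀ p ∈ K, φ p = p) (hc : ∀ p ∈ K, V p = c) (hcO : ∀ y ∈ O, y ∉ K → c < V y) :
    ∃ Q T : Set X, IsOpen Q ∧ IsCompact T ∧ K ⊆ Q ∧ Q ⊆ T ∧ T ⊆ O ∧ MapsTo φ Q Q := by
  obtain ⟨δ, hδ, hδO⟩ := hK.exists_cthickening_subset_open hO hKO
  have hTc : IsCompact (Metric.cthickening δ K) := hK.cthickening
  have hcont : Continuous fun x => Metric.infDist x K := Metric.continuous_infDist_pt K
  -- A point within `δ / 2` of `K` moves by less than `δ / 4`, so it cannot jump over this shell;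
  -- nor can it land there, where `V` is at least `c' > c`.
  have hshell : IsCompact (Metric.cthickening δ K ∩ {x | δ / 2 ≤ Metric.infDist x K}) :=
    hTc.inter_right (isClosed_le continuous_const hcont)
  obtain ⟨c', hcc', hc'⟩ := hshell.exists_forall_le' (f := V) (a := c) hV.continuousOn
    (fun x hx => hcO x (hδO hx.1) fun hxK => by
      have h1 := hx.2
      rw [mem_ofPred_eq, Metric.infDist_zero_of_mem hxK] at h1
      linarith)
  have hmem : ∀ x, Metric.infDist x K ≤ δ → x ∈ Metric.cthickening δ K := fun x hx => by
    rw [Metric.mem_cthickening_iff]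
    rw [Metric.infDist] at hx
    exact (ENNReal.le_ofReal_iff_toReal_le (Metric.infEDist_ne_top hKne) hδ.le).2 hx
  refine ⟨{x | Metric.infDist x K < δ / 2} ∩ {x | V x < c'}, Metric.cthickening δ K,
    (isOpen_lt hcont continuous_const).inter (isOpen_lt hV continuous_const), hTc, ?_, ?_, hδO, ?_⟩
  · intro x hx
    refine ⟨?_, ?_⟩
    · rw [mem_ofPred_eq, Metric.infDist_zero_of_mem hx]; linarith
    · rw [mem_ofPred_eq, hc x hx]; exact hcc'
  · rintro x ⟨hx, -⟩
    exact hmem x (by rw [mem_ofPred_eq] at hx; linarith)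
  · rintro x ⟨hx, hxV⟩
    rw [mem_ofPred_eq] at hx hxV
    obtain ⟨p, hpK, hp⟩ := hK.exists_infDist_eq_dist hKne x
    have h1 := hstep p (hfix p hpK) x
    have h2 : Metric.infDist (φ x) K ≤ dist (φ x) p := Metric.infDist_le_dist_of_mem hpK
    have h3 := dist_triangle (φ x) x p
    rw [hp] at hx
    have h4 : V (φ x) < c' := (hle x).trans_lt hxV
    refine ⟨?_, h4⟩
    by_contra hcon
    rw [mem_ofPred_eq, not_lt] at hcon
    exact absurd (hc' (φ x) ⟨hmem _ (by linarith), hcon⟩) (not_le.2 h4)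

/-- The basin of a compact part `A` of the set of minima is open and its orbits accumulate only
at `A`. -/
theorem exists_nhds_basin [ProperSpace X] (hφ : Continuous φ) (hV : Continuous V)
    (hle : ∀ x, V (φ x) ≤ V x) (hlt : ∀ x, φ x ≠ x → V (φ x) < V x)
    (hstep : ∀ p, φ p = p → ∀ x, dist (φ x) x ≤ 1 / 2 * dist x p) {A B : Set X}
    (hA : IsCompact A) (hB : IsClosed B) (hAB : Disjoint A B)
    (hfix : ∀ p ∈ A, φ p = p)
    (hloc : ∀ a ∈ A, ∃ O, IsOpen O ∧ a ∈ O ∧ ∀ y ∈ O, V a ≤ V y ∧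
      (V y = V a → y ∈ A ∪ B) ∧ (φ y = y → y ∈ A ∪ B))
    {x p : X} (hpA : p ∈ A) (hp : MapClusterPt p atTop fun n => φ^[n] x) :
    ∃ U, IsOpen U ∧ x ∈ U ∧ ∀ y ∈ U, (∃ q ∈ A, MapClusterPt q atTop fun n => φ^[n] y) ∧
      ∀ q, MapClusterPt q atTop (fun n => φ^[n] y) → q ∈ A := by
  choose! O hO hmemO hOV using hloc
  -- `V` may take several values on `A`; the trapping argument needs a single level.
  set K := A ∩ {y | V y = V p} with hK
  have hKc : IsCompact K := hA.inter_right (isClosed_eq hV continuous_const)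
  have hpK : p ∈ K := ⟨hpA, rfl⟩
  set W := (⋃ a ∈ K, O a) \ B with hW
  have hWo : IsOpen W := (isOpen_biUnion fun a ha => hO a ha.1).sdiff hB
  have hKW : K ⊆ W := fun a ha =>
    ⟨mem_biUnion ha (hmemO a ha.1), disjoint_left.1 hAB ha.1⟩
  have hWA : ∀ y ∈ W, φ y = y → y ∈ A := by
    rintro y ⟨hy, hyB⟩ hfy
    obtain ⟨a, ha, hya⟩ := mem_iUnion₂.1 hy
    exact ((hOV a ha.1 y hya).2.2 hfy).resolve_right hyB
  have hWV : ∀ y ∈ W, y ∉ K → V p < V y := by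
    rintro y ⟨hy, hyB⟩ hyK
    obtain ⟨a, ha, hya⟩ := mem_iUnion₂.1 hy
    have h1 := hOV a ha.1 y hya
    have h2 : V a = V p := ha.2
    rw [h2] at h1
    refine lt_of_le_of_ne h1.1 fun heq => hyK ⟨(h1.2.1 heq.symm).resolve_right hyB, heq.symm⟩
  obtain ⟨Q, T, hQ, hT, hKQ, hQT, hTW, hmaps⟩ := exists_trapping_neighbourhood hV hle hstep hKc
    ⟨p, hpK⟩ hWo hKW (fun a ha => hfix a ha.1) (fun a ha => ha.2) hWV
  refine ⟨⋃ n, (φ^[n]) ⁻¹' Q, isOpen_iUnion fun n => hQ.preimage (hφ.iterate n), ?_, ?_⟩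
  · obtain ⟨n, hn⟩ := (hp.frequently (hQ.mem_nhds (hKQ hpK))).exists
    exact mem_iUnion.2 ⟨n, hn⟩
  · intro y hy
    obtain ⟨n, hn⟩ := mem_iUnion.1 hy
    have hev : ∀ᶠ k in atTop, φ^[k] y ∈ T := by
      filter_upwards [eventually_ge_atTop n] with k hk
      obtain ⟨j, rfl⟩ := Nat.exists_eq_add_of_le' hk
      rw [Function.iterate_add_apply]
      exact hQT (hmaps.iterate j hn)
    have hall : ∀ q, MapClusterPt q atTop (fun n => φ^[n] y) → q ∈ A := by
      intro q hq
      have hqT : q ∈ T := by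
        by_contra hcon
        obtain ⟨k, hk1, hk2⟩ := ((hq.frequently
          (hT.isClosed.isOpen_compl.mem_nhds hcon)).and_eventually hev).exists
        exact hk1 hk2
      exact hWA q (hTW hqT) (fixed_of_mapClusterPt hφ hV hle hlt hq)
    obtain ⟨q, -, hq⟩ := hT.exists_mapClusterPt_of_frequently hev.frequently
    exact ⟨⟨q, hall q hq, hq⟩, hall⟩

/-- If the complement of the strict maxima is connected and the points whose orbit has no cluster
point form an open set, then the minima form a connected set. -/
theorem isPreconnected_of_descent_map [ProperSpace X] (hφ : Continuous φ)
    (hinj : Function.Injective φ) (hV : Continuous V) (hle : ∀ x, V (φ x) ≤ V x)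
    (hlt : ∀ x, φ x ≠ x → V (φ x) < V x)
    (hstep : ∀ p, φ p = p → ∀ x, dist (φ x) x ≤ 1 / 2 * dist x p) {S M : Set X}
    (hS : IsCompact S) (hSM : Disjoint S M) (hfix : ∀ p, φ p = p ↔ p ∈ S ∪ M)
    (hM : ∀ p ∈ M, ∀ᶠ y in 𝓝 p, y ≠ p → V y < V p) (hMc : IsPreconnected Mᶜ)
    (hloc : ∀ a ∈ S, ∃ O, IsOpen O ∧ a ∈ O ∧ ∀ y ∈ O, V a ≤ V y ∧
      (V y = V a → y ∈ S) ∧ (φ y = y → y ∈ S))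
    (hesc : IsOpen {x | ¬ ∃ p, MapClusterPt p atTop fun n => φ^[n] x}) :
    IsPreconnected S := by
  rw [isPreconnected_iff_subset_of_disjoint_closed]
  intro t t' ht ht' hcov hdisj
  set A := S ∩ t with hA
  set B := S ∩ t' with hB
  have hAc : IsCompact A := hS.inter_right ht
  have hBc : IsCompact B := hS.inter_right ht'
  have hAB : Disjoint A B := by
    rw [disjoint_left]
    intro y hy hy'
    have : y ∈ S ∩ (t ∩ t') := ⟨hy.1, hy.2, hy'.2⟩
    rw [hdisj] at this
    exact this
  have hSAB : S = A ∪ B := by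
    rw [hA, hB, ← inter_union_distrib_left, inter_eq_left.2 hcov]
  have hbasin : ∀ A' B' : Set X, IsCompact A' → IsCompact B' → Disjoint A' B' → S = A' ∪ B' →
      ∀ x, (∃ p ∈ A', MapClusterPt p atTop fun n => φ^[n] x) →
      ∃ U, IsOpen U ∧ x ∈ U ∧ ∀ y ∈ U, (∃ q ∈ A', MapClusterPt q atTop fun n => φ^[n] y) ∧
      ∀ q, MapClusterPt q atTop (fun n => φ^[n] y) → q ∈ A' := by
    rintro A' B' hA' hB' hAB' hSAB' x ⟨p, hpA, hp⟩
    refine exists_nhds_basin hφ hV hle hlt hstep hA' hB'.isClosed hAB'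
      (fun a ha => (hfix a).2 (Or.inl (hSAB' ▸ Or.inl ha))) ?_ hpA hp
    rw [← hSAB']
    exact fun a ha => hloc a (hSAB' ▸ Or.inl ha)
  have hbA := hbasin A B hAc hBc hAB hSAB
  have hbB := hbasin B A hBc hAc hAB.symm (hSAB.trans (union_comm A B))
  have hopen : ∀ A' : Set X, (∀ x, (∃ p ∈ A', MapClusterPt p atTop fun n => φ^[n] x) →
      ∃ U, IsOpen U ∧ x ∈ U ∧ ∀ y ∈ U, (∃ q ∈ A', MapClusterPt q atTop fun n => φ^[n] y) ∧
      ∀ q, MapClusterPt q atTop (fun n => φ^[n] y) → q ∈ A') →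
      IsOpen {x | ∃ p ∈ A', MapClusterPt p atTop fun n => φ^[n] x} := by
    intro A' h
    rw [isOpen_iff_mem_nhds]
    intro x hx
    obtain ⟨U, hU, hxU, hUA⟩ := h x hx
    filter_upwards [hU.mem_nhds hxU] with y hy using (hUA y hy).1
  have hself : ∀ a ∈ S, MapClusterPt a atTop fun n => φ^[n] a := by
    intro a ha
    have h1 : (fun n => φ^[n] a) = fun _ : ℕ => a := by
      ext n
      exact Function.iterate_fixed ((hfix a).2 (Or.inl ha)) n
    rw [h1]
    exact tendsto_const_nhds.mapClusterPt
  by_contra hcon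
  push Not at hcon
  obtain ⟨hnt, hnt'⟩ := hcon
  obtain ⟨b, hbS, hbt⟩ := not_subset.1 hnt
  obtain ⟨a, haS, hat⟩ := not_subset.1 hnt'
  have hbB' : b ∈ B := ⟨hbS, (hcov hbS).resolve_left hbt⟩
  have haA' : a ∈ A := ⟨haS, (hcov haS).resolve_right hat⟩
  -- The complement of the maxima is covered by the basin of `A` and by the basin of `B` together
  -- with the escaping orbits, so a common point exists; no orbit can do both.
  obtain ⟨x, hxM, hxu, hxv⟩ := hMc {x | ∃ p ∈ A, MapClusterPt p atTop fun n => φ^[n] x}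
    ({x | ∃ p ∈ B, MapClusterPt p atTop fun n => φ^[n] x} ∪
      {x | ¬ ∃ p, MapClusterPt p atTop fun n => φ^[n] x})
    (hopen A hbA) ((hopen B hbB).union hesc)
    (by
      intro x hx
      by_cases h : ∃ p, MapClusterPt p atTop fun n => φ^[n] x
      · obtain ⟨p, hp⟩ := h
        rcases (hfix p).1 (fixed_of_mapClusterPt hφ hV hle hlt hp) with hpS | hpM
        · rw [hSAB] at hpS
          rcases hpS with hpA | hpB
          · exact Or.inl ⟨p, hpA, hp⟩
          · exact Or.inr (Or.inl ⟨p, hpB, hp⟩)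
        · refine absurd ?_ hx
          rw [eq_of_mapClusterPt_of_strict_max hφ hinj hV hle hlt hp (hM p hpM)]
          exact hpM
      · exact Or.inr (Or.inr h))
    ⟨a, disjoint_left.1 hSM haS, a, haA', hself a haS⟩
    ⟨b, disjoint_left.1 hSM hbS, Or.inl ⟨b, hbB', hself b hbS⟩⟩
  obtain ⟨U, -, hxU, hUA⟩ := hbA x hxu
  rcases hxv with ⟨p, hpB, hp⟩ | hxv
  · exact disjoint_left.1 hAB ((hUA x hxU).2 p hp) hpB
  · obtain ⟨p, -, hp⟩ := hxu
    exact hxv ⟨p, hp⟩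

/-- Each orbit stays in a compact set, so the escape set is empty. -/
theorem isOpen_escape_of_coercive (hV : Tendsto V (cocompact X) atTop)
    (hle : ∀ x, V (φ x) ≤ V x) :
    IsOpen {x | ¬ ∃ p, MapClusterPt p atTop fun n => φ^[n] x} := by
  convert isOpen_empty
  rw [eq_empty_iff_forall_notMem]
  intro x hx
  refine hx ?_
  obtain ⟨K, hK, hKV⟩ := mem_cocompact.1 (hV.eventually (eventually_gt_atTop (V x)))
  have hmem : ∀ n, φ^[n] x ∈ K := by
    intro n
    by_contra hcon
    have h1 : V x < V (φ^[n] x) := hKV hcon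
    have h2 := iterate_value_antitone hle x (Nat.zero_le n)
    exact absurd h2 (not_le.2 h1)
  obtain ⟨p, -, hp⟩ := hK.exists_mapClusterPt_of_frequently
    (Eventually.of_forall hmem : ∀ᶠ n in atTop, φ^[n] x ∈ K).frequently
  exact ⟨p, hp⟩

/-- The escape set is open if the length of a step outside a compact set is controlled by the
decrease of `V`. -/
theorem isOpen_escape_of_step_le [CompleteSpace X] (hφ : Continuous φ) (hV : Continuous V)
    (hle : ∀ x, V (φ x) ≤ V x) (hlt : ∀ x, φ x ≠ x → V (φ x) < V x) {K : Set X}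
    (hK : IsCompact K) (hfix : ∀ p, φ p = p → p ∈ K)
    (hfar : ∀ x ∉ K, dist (φ x) x ≤ 2 * (V x - V (φ x))) :
    IsOpen {x | ¬ ∃ p, MapClusterPt p atTop fun n => φ^[n] x} := by
  obtain ⟨L, hL⟩ := hK.bddBelow_image hV.continuousOn
  -- Escaping means dropping below the bound `L` for `V` on `K`: an orbit staying above `L` either
  -- returns to `K` infinitely often or has summable steps and converges.
  have heq : {x | ¬ ∃ p, MapClusterPt p atTop fun n => φ^[n] x} =
      ⋃ n, {x | V (φ^[n] x) < L} := by
    ext x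
    rw [mem_ofPred_eq, mem_iUnion]
    constructor
    · contrapose!
      intro hx
      have hx' : ∀ n, L ≤ V (φ^[n] x) := fun n => not_lt.1 (hx n)
      by_cases hfr : ∃ᶠ n in atTop, φ^[n] x ∈ K
      · obtain ⟨p, -, hp⟩ := hK.exists_mapClusterPt_of_frequently hfr
        exact ⟨p, hp⟩
      · rw [not_frequently, eventually_atTop] at hfr
        obtain ⟨N, hN⟩ := hfr
        have hsum : Summable fun n =>
            2 * (V (φ^[n + N] x) - V (φ^[n + 1 + N] x)) := by
          refine summable_of_sum_range_le (c := 2 * (V (φ^[N] x) - L)) (fun n => ?_) fun n => ?_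
          · have := iterate_value_antitone hle x (by omega : n + N ≤ n + 1 + N)
            simp only at this
            linarith
          · rw [← Finset.mul_sum, Finset.sum_range_sub' (fun n => V (φ^[n + N] x)), zero_add]
            have := hx' (n + N)
            linarith
        have hc : CauchySeq fun n => φ^[n + N] x := by
          refine cauchySeq_of_dist_le_of_summable _ (fun n => ?_) hsum
          have h1 := hfar (φ^[n + N] x) (hN (n + N) (by omega))
          have h2 : φ^[n + 1 + N] x = φ (φ^[n + N] x) := by
            rw [← Function.iterate_succ_apply' φ, Nat.succ_eq_add_one, Nat.add_right_comm]
          rw [dist_comm, Nat.succ_eq_add_one, h2]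
          exact h1
        obtain ⟨p, hp⟩ := cauchySeq_tendsto_of_complete hc
        exact ⟨p, ((tendsto_add_atTop_iff_nat N).1 hp).mapClusterPt⟩
    · rintro ⟨n, hn⟩ ⟨p, hp⟩
      have h1 := hfix p (fixed_of_mapClusterPt hφ hV hle hlt hp)
      have h2 : L ≤ V p := hL ⟨p, h1, rfl⟩
      have h3 := value_le_of_mapClusterPt hV hle hp n
      rw [mem_ofPred_eq] at hn
      linarith
  rw [heq]
  exact isOpen_iUnion fun n => isOpen_lt (hV.comp (hφ.iterate n)) continuous_const

end Dynamics

/-! ### Critical points with negative definite Hessian. -/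

section NegativeDefinite

variable {E : Type*} [NormedAddCommGroup E] [InnerProductSpace ℝ E] [FiniteDimensional ℝ E]

theorem exists_neg_bound_of_neg_def {B : E →L[ℝ] E →L[ℝ] ℝ} (hB : ∀ v ≠ 0, B v v < 0) :
    ∃ c > 0, ∀ v, B v v ≤ -c * ‖v‖ ^ 2 := by
  have hcont : Continuous fun v => -B v v := by fun_prop
  obtain ⟨c, hc, hcB⟩ := (isCompact_sphere (0 : E) 1).exists_forall_le' (f := fun v => -B v v)
    (a := 0) hcont.continuousOn (fun v hv => by
      have : v ≠ 0 := by
        rintro rfl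
        simp at hv
      linarith [hB v this])
  refine ⟨c, hc, fun v => ?_⟩
  rcases eq_or_ne v 0 with rfl | hv
  · simp
  · have hn : 0 < ‖v‖ := norm_pos_iff.2 hv
    have h1 := hcB (‖v‖⁻¹ • v) (by simp [norm_smul, hn.ne'])
    simp only [map_smul, smul_apply, smul_eq_mul] at h1
    have h2 : ‖v‖⁻¹ * (‖v‖⁻¹ * B v v) * ‖v‖ ^ 2 = B v v := by field_simp
    nlinarith [mul_le_mul_of_nonneg_right h1 (sq_nonneg ‖v‖)]

/-- A critical point with negative definite Hessian is a strict local maximum and an isolated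
critical point. -/
theorem eventually_lt_and_gradient_ne {V : E → ℝ} (hV : ContDiff ℝ 2 V) {p : E}
    (hp : ∇ V p = 0) (hneg : ∀ v ≠ 0, fderiv ℝ (fderiv ℝ V) p v v < 0) :
    ∀ᶠ y in 𝓝 p, y ≠ p → V y < V p ∧ ∇ V y ≠ 0 := by
  obtain ⟨c, hc, hB⟩ := exists_neg_bound_of_neg_def hneg
  have hVd : Differentiable ℝ V := hV.differentiable (by norm_num)
  have hp' : fderiv ℝ V p = 0 := by
    rw [← toDual_gradient, hp, map_zero]
  have hd : HasFDerivAt (fderiv ℝ V) (fderiv ℝ (fderiv ℝ V) p) p :=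
    ((hV.fderiv_right (m := 1) (by norm_num)).differentiable (by norm_num) p).hasFDerivAt
  have hlit := hd.isLittleO.def (half_pos hc)
  -- Negativity of the radial derivative yields both claims: `V` decreases along segments from `p`,
  -- and the gradient cannot vanish.
  have hneg' : ∀ᶠ y in 𝓝 p, y ≠ p → fderiv ℝ V y (y - p) < 0 := by
    filter_upwards [hlit] with y hy hyp
    rw [hp', sub_zero] at hy
    have h1 : |(fderiv ℝ V y - fderiv ℝ (fderiv ℝ V) p (y - p)) (y - p)| ≤
        c / 2 * ‖y - p‖ * ‖y - p‖ :=
      ((fderiv ℝ V y - fderiv ℝ (fderiv ℝ V) p (y - p)).le_opNorm (y - p)).trans (by gcongr)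
    rw [sub_apply] at h1
    have h2 := (abs_le.1 h1).2
    have h3 := hB (y - p)
    have h4 : 0 < ‖y - p‖ := norm_pos_iff.2 (sub_ne_zero.2 hyp)
    nlinarith [mul_pos hc (mul_pos h4 h4)]
  obtain ⟨r, hr, hball⟩ := Metric.eventually_nhds_iff_ball.1 hneg'
  filter_upwards [Metric.ball_mem_nhds p hr] with y hy hyp
  refine ⟨?_, fun h0 => ?_⟩
  · have hderiv : ∀ t : ℝ, HasDerivAt (fun t : ℝ => V (p + t • (y - p)))
        (fderiv ℝ V (p + t • (y - p)) (y - p)) t := by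
      intro t
      have h1 : HasDerivAt (fun t : ℝ => p + t • (y - p)) (y - p) t := by
        simpa using ((hasDerivAt_id t).smul_const (y - p)).const_add p
      exact (hVd _).hasFDerivAt.comp_hasDerivAt t h1
    have hanti : StrictAntiOn (fun t : ℝ => V (p + t • (y - p))) (Icc 0 1) := by
      refine strictAntiOn_of_deriv_neg (convex_Icc 0 1)
        (fun t _ => (hderiv t).continuousAt.continuousWithinAt) fun t ht => ?_
      rw [interior_Icc] at ht
      rw [(hderiv t).deriv]
      have hdist : ‖y - p‖ < r := by rwa [mem_ball_iff_norm] at hy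
      have h2 := hball (p + t • (y - p)) (by
        rw [mem_ball_iff_norm, add_sub_cancel_left, norm_smul, Real.norm_of_nonneg ht.1.le]
        nlinarith [norm_nonneg (y - p), ht.2, ht.1]) (by
        intro h
        have : t • (y - p) = 0 := by simpa using h
        rcases smul_eq_zero.1 this with h | h
        · exact ht.1.ne' h
        · exact hyp (sub_eq_zero.1 h))
      rw [add_sub_cancel_left, map_smul, smul_eq_mul] at h2
      exact (pos_iff_neg_of_mul_neg h2).1 ht.1
    have := hanti (left_mem_Icc.2 zero_le_one) (right_mem_Icc.2 zero_le_one) zero_lt_one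
    simpa using this
  · have h1 := hball y hy hyp
    rw [← inner_gradient_left, h0, inner_zero_left] at h1
    exact lt_irrefl _ h1

end NegativeDefinite

/-- In a second countable space a function has at most countably many strict local maxima. -/
theorem countable_of_strict_local_max {X : Type*} [TopologicalSpace X] [SecondCountableTopology X]
    {V : X → ℝ} {M : Set X} (hM : ∀ p ∈ M, ∀ᶠ y in 𝓝 p, y ≠ p → V y < V p) : M.Countable := by
  have hB := TopologicalSpace.isBasis_countableBasis X
  have h : ∀ p ∈ M, ∃ U ∈ TopologicalSpace.countableBasis X, p ∈ U ∧
      ∀ y ∈ U, y ≠ p → V y < V p := by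
    intro p hp
    obtain ⟨U, hU, hpU, hUs⟩ := hB.mem_nhds_iff.1 (hM p hp)
    exact ⟨U, hU, hpU, fun y hy => hUs hy⟩
  choose! U hU hpU hlt using h
  refine MapsTo.countable_of_injOn (f := U) hU ?_
    (TopologicalSpace.countable_countableBasis X)
  intro p hp q hq hpq
  by_contra hne
  have h1 := hlt p hp q (hpq ▸ hpU q hq) (Ne.symm hne)
  have h2 := hlt q hq p (hpq ▸ hpU p hp) hne
  exact lt_asymm h1 h2

/-! ### The set of local minimizers: local form, compactness, connectedness. -/

section LocalStructure

variable {d : ℕ} {V : EuclideanSpace ℝ (Fin d) → ℝ}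
  {N : Set (EuclideanSpace ℝ (Fin d)) → Set (EuclideanSpace ℝ (Fin d))}

theorem gradient_eq_zero_of_mem_localMinimizers {x : EuclideanSpace ℝ (Fin d)}
    (hx : x ∈ localMinimizers V) : ∇ V x = 0 := by
  have h : IsLocalMin V x := hx
  rw [gradient, h.fderiv_eq_zero, map_zero]

/-- By the PŁ inequality a critical point in `N C` has the minimal value `m`; as `N C` is open,
points of value `m` are local minimizers. -/
theorem exists_nhds_of_isLocallyPL (hPL : IsLocallyPL V N) {C : Set (EuclideanSpace ℝ (Fin d))}
    (hC : C ∈ componentsOf (localMinimizers V)) :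
    ∃ ν > 0, ∃ m, ∀ y ∈ N C, m ≤ V y ∧ ν * (V y - m) ≤ ‖∇ V y‖ ^ 2 ∧
      (y ∈ localMinimizers V ↔ V y = m) ∧ (∇ V y = 0 → V y = m) := by
  obtain ⟨hopen, -, -, ν, hν, m, hm, hineq⟩ := hPL C hC
  have hle : ∀ y ∈ N C, m ≤ V y := fun y hy => hm.2 ⟨y, hy, rfl⟩
  have hcrit : ∀ y ∈ N C, ∇ V y = 0 → V y = m := by
    intro y hy h0
    have h1 := hineq y hy
    rw [h0, norm_zero] at h1
    have h2 : V y - m ≤ 0 := by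
      by_contra hcon
      push Not at hcon
      nlinarith [mul_pos hν hcon]
    linarith [hle y hy]
  refine ⟨ν, hν, m, fun y hy => ⟨hle y hy, hineq y hy,
    ⟨fun h => hcrit y hy (gradient_eq_zero_of_mem_localMinimizers h), fun h => ?_⟩, hcrit y hy⟩⟩
  filter_upwards [hopen.mem_nhds hy] with z hz
  rw [h]
  exact hle z hz

theorem localMinimizers_local_structure (hPL : IsLocallyPL V N) {a : EuclideanSpace ℝ (Fin d)}
    (ha : a ∈ localMinimizers V) :
    ∃ O, IsOpen O ∧ a ∈ O ∧ ContDiffOn ℝ 3 V O ∧ ∃ ν > 0, ∀ y ∈ O, V a ≤ V y ∧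
      ν * (V y - V a) ≤ ‖∇ V y‖ ^ 2 ∧ (y ∈ localMinimizers V ↔ V y = V a) ∧
      (∇ V y = 0 → y ∈ localMinimizers V) := by
  have hC : connectedComponentIn (localMinimizers V) a ∈ componentsOf (localMinimizers V) :=
    ⟨a, ha, rfl⟩
  obtain ⟨hopen, hsub, h3, -⟩ := hPL _ hC
  obtain ⟨ν, hν, m, h⟩ := exists_nhds_of_isLocallyPL hPL hC
  have haN := hsub (mem_connectedComponentIn ha)
  have ham : V a = m := (h a haN).2.2.1.1 ha
  refine ⟨_, hopen, haN, h3, ν, hν, fun y hy => ?_⟩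
  rw [ham]
  exact ⟨(h y hy).1, (h y hy).2.1, (h y hy).2.2.1, fun h0 => (h y hy).2.2.1.2 ((h y hy).2.2.2 h0)⟩

theorem neg_def_of_critical (hPL : IsLocallyPL V N) (hsaddle : HasNoSaddleOutside V N)
    {x : EuclideanSpace ℝ (Fin d)} (hx : ∇ V x = 0) (hxS : x ∉ localMinimizers V) :
    ∀ v ≠ 0, fderiv ℝ (fderiv ℝ V) x v v < 0 := by
  refine hsaddle x (fun hmem => hxS ?_) hx
  obtain ⟨C, hC, hxC⟩ := mem_iUnion₂.1 hmem
  obtain ⟨ν, -, m, h⟩ := exists_nhds_of_isLocallyPL hPL hC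
  exact (h x hxC).2.2.1.2 ((h x hxC).2.2.2 hx)

/-- A critical point that is not a local minimizer is isolated among critical points, so minimizers
cannot accumulate there. -/
theorem isClosed_localMinimizers (hV : ContDiff ℝ 2 V) (hPL : IsLocallyPL V N)
    (hsaddle : HasNoSaddleOutside V N) : IsClosed (localMinimizers V) := by
  have hG : Continuous (∇ V) :=
    (contDiff_iff_contDiffAt.2 fun x =>
      hV.contDiffAt.gradient (m := 1) (by norm_num) : ContDiff ℝ 1 (∇ V)).continuous
  rw [← isOpen_compl_iff, isOpen_iff_mem_nhds]
  intro y hy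
  by_cases h0 : ∇ V y = 0
  · filter_upwards [eventually_lt_and_gradient_ne hV h0 (neg_def_of_critical hPL hsaddle h0 hy)]
      with z hz hzS
    rcases eq_or_ne z y with rfl | hne
    · exact hy hzS
    · exact (hz hne).2 (gradient_eq_zero_of_mem_localMinimizers hzS)
  · filter_upwards [hG.continuousAt.eventually_ne h0] with z hz hzS
    exact hz (gradient_eq_zero_of_mem_localMinimizers hzS)

theorem exists_sliceChart_localMinimizers (hPL : IsLocallyPL V N) {a : EuclideanSpace ℝ (Fin d)}
    (ha : a ∈ localMinimizers V) :
    ∃ k, ∃ c : SliceChart k (localMinimizers V), a ∈ c.chart.source := by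
  obtain ⟨O, hO, haO, h3, ν, hν, h⟩ := localMinimizers_local_structure hPL ha
  have hev : ∀ᶠ y in 𝓝 a, y ∈ O := hO.mem_nhds haO
  exact exists_sliceChart (h3.contDiffAt hev) hν ha (hev.mono fun y hy => (h y hy).2.2.1)
    (hev.mono fun y hy => (h y hy).1) (hev.mono fun y hy => (h y hy).2.1)

theorem isCompact_localMinimizers (hV : ContDiff ℝ 2 V) (hPL : IsLocallyPL V N)
    (hsaddle : HasNoSaddleOutside V N)
    (hgrowth : IsCoerciveWithBoundedMinima V ∨ HasErrorBoundAtInfinity V) :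
    IsCompact (localMinimizers V) := by
  have hcl := isClosed_localMinimizers hV hPL hsaddle
  rcases hgrowth with ⟨-, K, hK, hSK⟩ | ⟨-, R, -, -, -, hR, -⟩
  · exact hK.of_isClosed_subset hcl hSK
  · exact (isCompact_closedBall 0 R).of_isClosed_subset hcl fun x hx => by simpa using hR x hx

theorem isPreconnected_localMinimizers (hd : 1 < d) (hV : ContDiff ℝ 2 V) (hPL : IsLocallyPL V N)
    (hsaddle : HasNoSaddleOutside V N)
    (hgrowth : IsCoerciveWithBoundedMinima V ∨ HasErrorBoundAtInfinity V) :
    IsPreconnected (localMinimizers V) := by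
  obtain ⟨η, hη, hlip, hdesc⟩ := exists_descent_step hV
  set φ : EuclideanSpace ℝ (Fin d) → EuclideanSpace ℝ (Fin d) := fun x => x - η x • ∇ V x with hφ
  have hW : LipschitzWith (1 / 2) fun x => η x • ∇ V x :=
    LipschitzWith.of_dist_le_mul fun x y => by
      simpa [dist_eq_norm] using hlip x y
  have hφc : Continuous φ := continuous_id.sub hW.continuous
  have hfix0 : ∀ p, φ p = p ↔ ∇ V p = 0 := fun p => by
    simp [hφ, (hη p).ne']
  have hinj : Function.Injective φ := by
    intro x y hxy
    have h1 : x - y = η x • ∇ V x - η y • ∇ V y := by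
      simp only [hφ] at hxy
      rw [sub_eq_sub_iff_sub_eq_sub] at hxy
      exact hxy
    have h2 := hlip x y
    rw [← h1] at h2
    have h3 := norm_nonneg (x - y)
    exact sub_eq_zero.1 (norm_eq_zero.1 (by linarith))
  have hlt : ∀ x, φ x ≠ x → V (φ x) < V x := by
    intro x hx
    have h1 : 0 < ‖∇ V x‖ := norm_pos_iff.2 fun h => hx ((hfix0 x).2 h)
    have h2 := hdesc x
    have h3 : 0 < η x / 2 * ‖∇ V x‖ ^ 2 := by have := hη x; positivity
    simp only [hφ]
    linarith
  have hle : ∀ x, V (φ x) ≤ V x := by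
    intro x
    by_cases h : φ x = x
    · rw [h]
    · exact (hlt x h).le
  have hdist : ∀ x, dist (φ x) x = η x * ‖∇ V x‖ := fun x => by
    rw [dist_eq_norm]
    simp only [hφ]
    rw [sub_sub_cancel_left, norm_neg, norm_smul, Real.norm_of_nonneg (hη x).le]
  have hstep : ∀ p, φ p = p → ∀ x, dist (φ x) x ≤ 1 / 2 * dist x p := by
    intro p hp x
    have h1 := hlip x p
    rw [(hfix0 p).1 hp, smul_zero, sub_zero] at h1
    rw [dist_eq_norm, dist_eq_norm]
    simp only [hφ]
    rwa [sub_sub_cancel_left, norm_neg]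
  set M : Set (EuclideanSpace ℝ (Fin d)) := {x | ∇ V x = 0 ∧ x ∉ localMinimizers V} with hM
  have hmax : ∀ p ∈ M, ∀ᶠ y in 𝓝 p, y ≠ p → V y < V p := by
    rintro p ⟨hp, hpS⟩
    filter_upwards [eventually_lt_and_gradient_ne hV hp (neg_def_of_critical hPL hsaddle hp hpS)]
      with y hy hne using (hy hne).1
  -- This is where `1 < d` enters: removing countably many points disconnects a line.
  have hMc : IsPreconnected Mᶜ := by
    refine ((countable_of_strict_local_max hmax).isPathConnected_compl_of_one_lt_rank
      ?_).isConnected.isPreconnected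
    rw [← Module.finrank_eq_rank, finrank_euclideanSpace_fin]
    exact_mod_cast hd
  refine isPreconnected_of_descent_map hφc hinj hV.continuous hle hlt hstep (M := M)
    (isCompact_localMinimizers hV hPL hsaddle hgrowth) ?_ ?_ hmax hMc ?_ ?_
  · rw [disjoint_left]
    exact fun x hx hx' => hx'.2 hx
  · intro p
    rw [hfix0]
    constructor
    · intro hp
      by_cases h : p ∈ localMinimizers V
      · exact Or.inl h
      · exact Or.inr ⟨hp, h⟩
    · rintro (h | h)
      · exact gradient_eq_zero_of_mem_localMinimizers h
      · exact h.1
  · intro a ha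
    obtain ⟨O, hO, haO, -, ν, -, h⟩ := localMinimizers_local_structure hPL ha
    exact ⟨O, hO, haO, fun y hy => ⟨(h y hy).1, (h y hy).2.2.1.2,
      fun hy' => (h y hy).2.2.2 ((hfix0 y).1 hy')⟩⟩
  · rcases hgrowth with ⟨hco, -⟩ | ⟨hne, R, hR, ν, hν, hSR, heb⟩
    · exact isOpen_escape_of_coercive hco hle
    · have hgrad : ∀ x, R + 1 / ν ≤ ‖x‖ → 1 ≤ ‖∇ V x‖ := by
        intro x hx
        have h0 : 0 < 1 / ν := by positivity
        have h1 := heb x (by linarith)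
        have h2 : 1 / ν ≤ Metric.infDist x (localMinimizers V) := by
          rw [Metric.le_infDist hne]
          intro y hy
          have h3 := norm_sub_norm_le x y
          rw [dist_eq_norm]
          linarith [hSR y hy]
        have h3 : ν * (1 / ν) = 1 := by field_simp
        have h4 := mul_le_mul_of_nonneg_left h2 hν.le
        linarith
      refine isOpen_escape_of_step_le hφc hV.continuous hle hlt
        (isCompact_closedBall (0 : EuclideanSpace ℝ (Fin d)) (R + 1 / ν)) ?_ ?_
      · intro p hp
        rw [mem_closedBall_zero_iff]
        by_contra hcon
        have h1 := hgrad p (not_le.1 hcon).le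
        rw [(hfix0 p).1 hp, norm_zero] at h1
        linarith
      · intro x hx
        rw [mem_closedBall_zero_iff, not_le] at hx
        have h1 := hgrad x hx.le
        have h2 := hdesc x
        rw [hdist]
        have h3 : η x * ‖∇ V x‖ ≤ η x * ‖∇ V x‖ ^ 2 := by
          have := (hη x).le
          gcongr
          nlinarith
        simp only [hφ]
        linarith

end LocalStructure

/-! ### Constancy and bound of the dimension. -/

/-- The open set covered by the slice charts of `M` of dimension `k`. -/
def sliceDomain {E : Type*} [NormedAddCommGroup E] [InnerProductSpace ℝ E] (k : ℕ) (M : Set E) :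
    Set E :=
  ⋃ c : SliceChart k M, c.chart.source

theorem isOpen_sliceDomain {E : Type*} [NormedAddCommGroup E] [InnerProductSpace ℝ E] (k : ℕ)
    (M : Set E) : IsOpen (sliceDomain k M) :=
  isOpen_iUnion fun c => c.chart.open_source

theorem eq_of_mem_sliceDomain {E : Type*} [NormedAddCommGroup E] [InnerProductSpace ℝ E]
    [FiniteDimensional ℝ E] {k j : ℕ} {M : Set E} {x : E} (hx : x ∈ M) (hk : x ∈ sliceDomain k M)
    (hj : x ∈ sliceDomain j M) : k = j := by
  obtain ⟨c, hc⟩ := mem_iUnion.1 hk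
  obtain ⟨c', hc'⟩ := mem_iUnion.1 hj
  exact le_antisymm (c.le_of_mem c' hx hc hc') (c'.le_of_mem c hx hc' hc)

/-- The slice charts of a compact set have positive codimension. -/
theorem lt_of_mem_sliceDomain {d : ℕ} (hd : 1 ≤ d) {M : Set (EuclideanSpace ℝ (Fin d))}
    (hM : IsCompact M) (hcov : ∀ x ∈ M, ∃ k, x ∈ sliceDomain k M) {k : ℕ}
    {x : EuclideanSpace ℝ (Fin d)} (hk : x ∈ sliceDomain k M) : k < d := by
  have hle : k ≤ d := by
    obtain ⟨c, -⟩ := mem_iUnion.1 hk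
    have := c.plane.finrank_le
    rwa [c.finrank_plane, finrank_euclideanSpace_fin] at this
  refine lt_of_le_of_ne hle fun hkd => ?_
  have hsub : sliceDomain k M ⊆ M := by
    intro y hy
    obtain ⟨c, hc⟩ := mem_iUnion.1 hy
    have htop : c.plane = ⊤ :=
      Submodule.eq_top_of_finrank_eq (by rw [c.finrank_plane, finrank_euclideanSpace_fin, hkd])
    rw [c.mem_iff y hc, htop]
    trivial
  -- The full-dimensional part is thus closed as well as open in `ℝ^d`, hence empty or everything;
  -- compactness of `M` excludes the latter.
  have heq : sliceDomain k M = M \ ⋃ j ∈ {j | j ≠ k}, sliceDomain j M := by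
    ext y
    constructor
    · intro hy
      refine ⟨hsub hy, fun hy' => ?_⟩
      obtain ⟨j, hj, hyj⟩ := mem_iUnion₂.1 hy'
      exact hj (eq_of_mem_sliceDomain (hsub hy) hyj hy)
    · rintro ⟨hyM, hy⟩
      obtain ⟨j, hj⟩ := hcov y hyM
      by_cases hjk : j = k
      · subst hjk
        exact hj
      · exact absurd (mem_biUnion (show j ∈ {j | j ≠ k} from hjk) hj) hy
  have hclosed : IsClosed (sliceDomain k M) := by
    rw [heq, Set.sdiff_eq]
    exact hM.isClosed.inter
      (isOpen_biUnion fun j _ => isOpen_sliceDomain j M).isClosed_compl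
  have : Nonempty (Fin d) := ⟨⟨0, hd⟩⟩
  rcases isClopen_iff.1 ⟨hclosed, isOpen_sliceDomain k M⟩ with h | h
  · rw [h] at hk
    exact hk
  · rw [h, univ_subset_iff] at hsub
    rw [hsub] at hM
    exact noncompact_univ _ hM

/-- For `d = 1` positive codimension leaves only `0`; otherwise the domains of different dimensions
cut the connected set `M` into disjoint relatively open pieces. -/
theorem exists_subset_sliceDomain {d : ℕ} (hd : 1 ≤ d) {M : Set (EuclideanSpace ℝ (Fin d))}
    (hM : IsCompact M) (hcov : ∀ x ∈ M, ∃ k, x ∈ sliceDomain k M)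
    (hconn : 1 < d → IsPreconnected M) : ∃ k < d, M ⊆ sliceDomain k M := by
  rcases hd.eq_or_lt with rfl | hd'
  · refine ⟨0, one_pos, fun x hx => ?_⟩
    obtain ⟨k, hk⟩ := hcov x hx
    have := lt_of_mem_sliceDomain le_rfl hM hcov hk
    obtain rfl : k = 0 := by omega
    exact hk
  · rcases M.eq_empty_or_nonempty with rfl | ⟨x, hx⟩
    · exact ⟨0, hd, empty_subset _⟩
    · obtain ⟨k, hk⟩ := hcov x hx
      refine ⟨k, lt_of_mem_sliceDomain hd hM hcov hk, ?_⟩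
      have hdisj : ∀ y ∈ M, y ∈ sliceDomain k M → y ∉ ⋃ j ∈ {j | j ≠ k}, sliceDomain j M := by
        intro y hyM hy hy'
        obtain ⟨j, hj, hyj⟩ := mem_iUnion₂.1 hy'
        exact hj (eq_of_mem_sliceDomain hyM hyj hy)
      refine (isPreconnected_iff_subset_of_disjoint.1 (hconn hd') _ _ (isOpen_sliceDomain k M)
        (isOpen_biUnion fun j (_ : j ∈ {j | j ≠ k}) => isOpen_sliceDomain j M) ?_ ?_).resolve_right
        fun h => hdisj x hx hk (h hx)
      · intro y hy
        obtain ⟨j, hj⟩ := hcov y hy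
        by_cases hjk : j = k
        · exact Or.inl (hjk ▸ hj)
        · exact Or.inr (mem_biUnion (show j ∈ {j | j ≠ k} from hjk) hj)
      · rw [eq_empty_iff_forall_notMem]
        rintro y ⟨hyM, hy, hy'⟩
        exact hdisj y hyM hy hy'

/-! ### Global minimizers and conclusion. -/

theorem globalMinimizers_subset_localMinimizers {d : ℕ} {V : EuclideanSpace ℝ (Fin d) → ℝ} :
    globalMinimizers V ⊆ localMinimizers V :=
  fun _ hx => Eventually.of_forall hx

theorem isClosed_globalMinimizers {d : ℕ} {V : EuclideanSpace ℝ (Fin d) → ℝ}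
    (hV : Continuous V) : IsClosed (globalMinimizers V) := by
  have h : globalMinimizers V = ⋂ y, {x | V x ≤ V y} := by
    ext x
    simp [globalMinimizers]
  rw [h]
  exact isClosed_iInter fun y => isClosed_le hV continuous_const

theorem mainTheorem5 (d : ℕ) (hd : 1 ≤ d)
    (V : EuclideanSpace ℝ (Fin d) → ℝ) (hV : ContDiff ℝ 2 V)
    (N : Set (EuclideanSpace ℝ (Fin d)) → Set (EuclideanSpace ℝ (Fin d)))
    (hPL : IsLocallyPL V N)
    (hsaddle : HasNoSaddleOutside V N)
    (hgrowth : IsCoerciveWithBoundedMinima V ∨ HasErrorBoundAtInfinity V) :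
    ∃ k : ℕ, k < d ∧
      (IsCompact (localMinimizers V) ∧ IsC2EmbeddedSubmanifold k (localMinimizers V)) ∧
      (IsCompact (globalMinimizers V) ∧ IsC2EmbeddedSubmanifold k (globalMinimizers V)) := by
  have hS := isCompact_localMinimizers hV hPL hsaddle hgrowth
  obtain ⟨k, hk, hsub⟩ := exists_subset_sliceDomain hd hS
    (fun x hx => by
      obtain ⟨k, c, hc⟩ := exists_sliceChart_localMinimizers hPL hx
      exact ⟨k, mem_iUnion.2 ⟨c, hc⟩⟩)
    (fun hd' => isPreconnected_localMinimizers hd' hV hPL hsaddle hgrowth)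
  have hchart : ∀ x ∈ localMinimizers V, ∃ c : SliceChart k (localMinimizers V),
      x ∈ c.chart.source := fun x hx => mem_iUnion.1 (hsub hx)
  refine ⟨k, hk, ⟨hS, isC2EmbeddedSubmanifold_of_sliceChart hchart⟩,
    hS.of_isClosed_subset (isClosed_globalMinimizers hV.continuous)
      globalMinimizers_subset_localMinimizers,
    isC2EmbeddedSubmanifold_of_sliceChart fun x hx => ?_⟩
  have hxS := globalMinimizers_subset_localMinimizers hx
  obtain ⟨c, hc⟩ := hchart x hxS
  obtain ⟨O, hO, hxO, -, ν, -, h⟩ := localMinimizers_local_structure hPL hxS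
  -- Local minimizers near `x` share the value `V x`, hence are global too.
  refine ⟨c.restr hO fun y hy => ⟨fun h' => globalMinimizers_subset_localMinimizers h',
    fun h' z => ?_⟩, hc, hxO⟩
  rw [(h y hy).2.2.1.1 h']
  exact hx z
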